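/- Let $-A$ be the generator of a bounded $C_0$-semigroup $(e^{-tA})_{t\ge 0}$ on a complex Banach space $X$, with $\overline{\operatorname{ran}}(A)=X$, and suppose that $\sigma(A)\cap i\mathbb R$ has an accumulation point at infinity (i.e. is unbounded). Put $\Delta_{n,t}(A):=(1+\tfrac tn A)^{-n}-e^{-tA}$ for $n\in\mathbb N$, $n\ge 1$, $t>0$. A Stieltjes function is a function of the form $z\mapsto a+\int_{[0,\infty)}\frac{\mu(d\tau)}{z+\tau}$, with $a\ge 0$ and $\mu$ a positive Radon measure on $[0,\infty)$ such that $\int_{[0,\infty)}\frac{\mu(d\tau)}{1+\tau}<\infty$; it is defined on $(0,\infty)$ and identified with its analytic extension, given by the same formula, to $\mathbb C\setminus(-\infty,0]$. Let $f=f_1f_2$ with $f_1,f_2$ Stieltjes functions, and suppose that $\lim_{\tau\to\infty}\tau^2f(\tau)=\infty$. Let $f(A)$ be defined by the extended Hille–Phillips calculus: if $g(z)=\int_{[0,\infty)} e^{-sz}\,\mu(ds)$ for $\operatorname{Re}z>0$, where $\mu$ is a bounded complex Radon measure on $[0,\infty)$, then $g(A)x:=\int_{[0,\infty)} e^{-sA}x\,\mu(ds)$,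 $x\in X$; and $f(A):=e(A)^{-1}(ef)(A)$, with its natural domain, where $e$ is any function such that $e$ and $ef$ are both Laplace transforms of bounded complex Radon measures on $[0,\infty)$ and $e(A)$ is injective (the result does not depend on the choice of $e$). Then for every decreasing function $\epsilon:(0,\infty)\to(0,\infty)$ with $\lim_{\tau\to\infty}\epsilon(\tau)=0$ there exists $y\in\operatorname{ran}(f(A))$ such that $$\limsup_{\sqrt n/t\to\infty}\frac{\|\Delta_{n,t}(A)y\|}{\epsilon(\sqrt n/t)\,f(\sqrt n/t)}=\infty .$$ -/

import Mathlib

open Filter Topology MeasureTheory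
open scoped NNReal

noncomputable section

namespace EulerRate

variable {X : Type*} [NormedAddCommGroup X] [NormedSpace ℂ X]

/-- `T` is a bounded `C₀`-semigroup on `X` (time runs through `[0, ∞)`). -/
structure IsBoundedC0Semigroup (T : ℝ≥0 → X →L[ℂ] X) : Prop where
  map_zero : T 0 = 1
  map_add : ∀ s t, T (s + t) = T s * T t
  strong_continuity : ∀ x, Tendsto (fun t => T t x) (𝓝 0) (𝓝 x)
  bounded : ∃ M : ℝ, ∀ t, ‖T t‖ ≤ M

/-- `-A` is the (infinitesimal) generator of `T`: `x` lies in the domain of `A` and `A x = y` if and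
only if `(x - T t x) / t` tends to `y` as `t → 0+`. -/
def IsNegGenerator (T : ℝ≥0 → X →L[ℂ] X) (A : X →ₗ.[ℂ] X) : Prop :=
  ∀ x y, (x, y) ∈ A.graph ↔
    Tendsto (fun t : ℝ≥0 => ((t : ℝ) : ℂ)⁻¹ • (x - T t x)) (𝓝[>] 0) (𝓝 y)

/-- `R` is a bounded, everywhere defined, two-sided inverse of the operator `a + b A`, whose domain
is the domain of `A`. -/
def IsBoundedInverse (A : X →ₗ.[ℂ] X) (a b : ℂ) (R : X →L[ℂ] X) : Prop :=
  (∀ y, ∃ h : R y ∈ A.domain, a • R y + b • A ⟨R y, h⟩ = y) ∧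
    ∀ x : A.domain, R (a • (x : X) + b • A x) = x

/-- The spectrum of `A`: all `z` for which `z - A` has no bounded everywhere defined inverse. -/
def opSpectrum (A : X →ₗ.[ℂ] X) : Set ℂ :=
  {z | ¬ ∃ R : X →L[ℂ] X, IsBoundedInverse A z (-1) R}

open Classical in
/-- The operator `(1 + h A)⁻¹` (and `0` if `1 + h A` is not boundedly invertible, which does not
happen if `-A` generates a bounded `C₀`-semigroup and `h > 0`). -/
def backwardStep (A : X →ₗ.[ℂ] X) (h : ℝ) : X →L[ℂ] X :=
  if H : ∃ R : X →L[ℂ] X, IsBoundedInverse A 1 (h : ℂ) R then H.choose else 0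

/-- The operator `Δ_{n,t}(A) = (1 + (t / n) A)⁻ⁿ - e^{-tA}`, where `e^{-tA} = T t`. -/
def eulerError (T : ℝ≥0 → X →L[ℂ] X) (A : X →ₗ.[ℂ] X) (n : ℕ) (t : ℝ≥0) : X →L[ℂ] X :=
  backwardStep A ((t : ℝ) / n) ^ n - T t

/-- The Laplace transform `z ↦ ∫ e^{-sz} μ(ds)` of a bounded complex measure on `[0, ∞)`. -/
def laplace (μ : ComplexMeasure ℝ≥0) (z : ℂ) : ℂ :=
  VectorMeasure.integral μ (fun s : ℝ≥0 => Complex.exp (-((s : ℝ) : ℂ) * z))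
    (ContinuousLinearMap.mul ℝ ℂ)

/-- The Hille–Phillips calculus: the operator `g(A) : x ↦ ∫ e^{-sA} x μ(ds)`, where `g` is the
Laplace transform of `μ` and `e^{-sA} = T s`. -/
def hillePhillips (T : ℝ≥0 → X →L[ℂ] X) (μ : ComplexMeasure ℝ≥0) (x : X) : X :=
  VectorMeasure.integral μ (fun s : ℝ≥0 => T s x) (ContinuousLinearMap.lsmul ℝ ℂ).flip

/-- `e = laplace μ` is a regularizer for `f`, and `e f = laplace ν`: the operator `e(A)` is injective
and `e f` is the Laplace transform of the bounded complex measure `ν` on the open right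
half-plane. -/
def IsRegularizer (T : ℝ≥0 → X →L[ℂ] X) (f : ℂ → ℂ) (μ ν : ComplexMeasure ℝ≥0) : Prop :=
  (∀ z : ℂ, 0 < z.re → laplace ν z = laplace μ z * f z) ∧
    Function.Injective (hillePhillips T μ)

/-- The graph of `f(A)` in the extended Hille–Phillips calculus: `f` is holomorphic on the open right
half-plane and, for some regularizer `e` of `f`, `e(A) y = (e f)(A) x`, that is,
`y = e(A)⁻¹ (e f)(A) x`. The choice of the regularizer does not matter. If `f` has no regularizer,
then the graph is empty. -/
def IsExtendedCalculusValue (T : ℝ≥0 → X →L[ℂ] X) (f : ℂ → ℂ) (x y : X) : Prop :=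
  DifferentiableOn ℂ f {z : ℂ | 0 < z.re} ∧
    ∃ μ ν : ComplexMeasure ℝ≥0, IsRegularizer T f μ ν ∧
      hillePhillips T μ y = hillePhillips T ν x

/-- The range of `f(A)`. -/
def extendedCalculusRange (T : ℝ≥0 → X →L[ℂ] X) (f : ℂ → ℂ) : Set X :=
  {y | ∃ x, IsExtendedCalculusValue T f x y}

/-- Stieltjes functions `a + ∫ μ(dτ) / (z + τ)`, with `a ≥ 0` and `μ` a positive measure on `[0, ∞)`
such that `∫ μ(dτ) / (1 + τ) < ∞`, given by their analytic extension to `ℂ ∖ (-∞, 0]`. -/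
def IsStieltjes (f : ℂ → ℂ) : Prop :=
  ∃ (a : ℝ) (μ : Measure ℝ≥0), 0 ≤ a ∧ Integrable (fun τ : ℝ≥0 => (1 + (τ : ℝ))⁻¹) μ ∧
    ∀ z ∈ Complex.slitPlane, f z = a + ∫ τ : ℝ≥0, (z + ((τ : ℝ) : ℂ))⁻¹ ∂μ

/-- Products of two Stieltjes functions (on `ℂ ∖ (-∞, 0]`). -/
def IsStieltjesProduct (f : ℂ → ℂ) : Prop :=
  ∃ f₁ f₂ : ℂ → ℂ, IsStieltjes f₁ ∧ IsStieltjes f₂ ∧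
    ∀ z ∈ Complex.slitPlane, f z = f₁ z * f₂ z

/-- The filter `√n / t → ∞` on the pairs `(n, t)` with `n ≥ 1` and `t > 0`. -/
def sqrtRatioFilter : Filter (ℕ × ℝ≥0) :=
  comap (fun p : ℕ × ℝ≥0 => Real.sqrt p.1 / (p.2 : ℝ)) atTop ⊓ 𝓟 {p | 1 ≤ p.1 ∧ 0 < p.2}

end EulerRate

end

open EulerRate

/-! The single Euler step n = 1 suffices. Let iw lie in the spectrum of A with |w| ≥ 1 and put t =
1/|w|, so that √n/t = |w|. At z = iw the function 1/(1 + tz) - e^{-tz} has modulus at least 1 - 1/√2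
≥ 1/4, because its two terms have moduli 1/√2 and 1. A Stieltjes function g satisfies g(|w|) ≤ √2
|g(iw)|, so a product f of two satisfies f(|w|) ≤ 2 |f(iw)|. With e(z) = (z/(1+z))², which has
modulus at least 1/2 at iw, the symbol of Δ_{1,t}(A) (ef)(A) therefore has modulus at least
f(|w|)/16 there.

Symbols bound operators from below: the open left half-plane lies in the resolvent set of A, so iw
is an approximate eigenvalue, and the same approximate eigenvectors serve every operator of the
semigroup (`exists_approximate_eigenvectors`). Integration carries this over to the whole
Hille–Phillips calculus, whence ‖Δ_{1,t}(A) (ef)(A)‖ ≥ f(|w|)/16 (`re_le_norm_eulerError_mul`).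

Divided by ε(|w|) f(|w|), these operators have norms at least 1/(16 ε(|w|)), unbounded along the
spectrum. By Banach–Steinhaus some vector x has an unbounded orbit, and y = (ef)(A) x = f(A) e(A) x
lies in the range of f(A). That e regularizes f is `IsStieltjesProduct.exists_operator`. -/

namespace EulerRate

/-! ### Averages of the semigroup against finite measures. -/

section Averages

variable {X : Type*} [NormedAddCommGroup X] [NormedSpace ℂ X] {T : ℝ≥0 → X →L[ℂ] X}

theorem IsBoundedC0Semigroup.exists_bound (hT : IsBoundedC0Semigroup T) :
    ∃ M : ℝ, 0 ≤ M ∧ ∀ t x, ‖T t x‖ ≤ M * ‖x‖ := by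
  obtain ⟨M, hM⟩ := hT.bounded
  exact ⟨M, (norm_nonneg _).trans (hM 0), fun t x => (T t).le_of_opNorm_le (hM t) x⟩

theorem IsBoundedC0Semigroup.continuous (hT : IsBoundedC0Semigroup T) (x : X) :
    Continuous (fun t => T t x) := by
  obtain ⟨M, hM0, hM⟩ := hT.exists_bound
  have aux : ∀ s d : ℝ≥0, ‖T (s + d) x - T s x‖ ≤ M * ‖T d x - x‖ := by
    intro s d
    rw [hT.map_add, mul_apply_eq_comp, ← map_sub]
    exact hM _ _
  -- Factoring out the smaller time reduces continuity everywhere, from both sides, to continuity at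
  -- 0.
  have key : ∀ s t : ℝ≥0, ‖T s x - T t x‖ ≤ M * ‖T (nndist s t) x - x‖ := by
    intro s t
    rcases le_total s t with h | h
    · obtain ⟨d, rfl⟩ := exists_add_of_le h
      have : nndist s (s + d) = d := by
        ext; simp [NNReal.dist_eq]
      rw [this, norm_sub_rev]
      exact aux s d
    · obtain ⟨d, rfl⟩ := exists_add_of_le h
      have : nndist (t + d) t = d := by
        ext; simp [NNReal.dist_eq]
      rw [this]
      exact aux t d
  rw [continuous_iff_continuousAt]
  intro t
  rw [ContinuousAt, tendsto_iff_norm_sub_tendsto_zero]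
  have h1 : Tendsto (fun s : ℝ≥0 => nndist s t) (𝓝 t) (𝓝 0) := by
    have : Continuous (fun s : ℝ≥0 => nndist s t) := by fun_prop
    simpa using this.tendsto t
  have h2 := (tendsto_iff_norm_sub_tendsto_zero.1 (hT.strong_continuity x)).comp h1
  have h3 := h2.const_mul M
  rw [mul_zero] at h3
  exact squeeze_zero (fun _ => norm_nonneg _) (fun s => key s t) h3

theorem IsBoundedC0Semigroup.integrable (hT : IsBoundedC0Semigroup T) (m : Measure ℝ≥0)
    [IsFiniteMeasure m] (x : X) : Integrable (fun s => T s x) m := by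
  obtain ⟨M, -, hM⟩ := hT.exists_bound
  exact Integrable.of_bound (hT.continuous x).aestronglyMeasurable (M * ‖x‖)
    (Eventually.of_forall fun s => hM s x)

/-- The average `x ↦ ∫ T s x m(ds)` of a bounded semigroup against a finite measure. -/
noncomputable def average (hT : IsBoundedC0Semigroup T) (m : Measure ℝ≥0) [IsFiniteMeasure m] :
    X →L[ℂ] X :=
  LinearMap.mkContinuousOfExistsBound
    { toFun := fun x => ∫ s, T s x ∂m
      map_add' := fun x y => by
        simp only [map_add]
        exact integral_add (hT.integrable m x) (hT.integrable m y)
      map_smul' := fun c x => by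
        simp only [map_smul, RingHom.id_apply]
        exact integral_smul c _ }
    (by
      obtain ⟨M, -, hM⟩ := hT.exists_bound
      refine ⟨M * m.real Set.univ, fun x => ?_⟩
      refine (norm_integral_le_of_norm_le_const (Eventually.of_forall fun s => hM s x)).trans ?_
      exact le_of_eq (by ring))

theorem average_apply (hT : IsBoundedC0Semigroup T) (m : Measure ℝ≥0) [IsFiniteMeasure m] (x : X) :
    average hT m x = ∫ s, T s x ∂m := rfl

theorem IsBoundedC0Semigroup.commute (hT : IsBoundedC0Semigroup T) (s t : ℝ≥0) (x : X) :
    T s (T t x) = T t (T s x) := by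
  rw [← mul_apply_eq_comp, ← mul_apply_eq_comp, ← hT.map_add,
    ← hT.map_add, add_comm]

variable [CompleteSpace X]

theorem average_comm_semigroup (hT : IsBoundedC0Semigroup T) (m : Measure ℝ≥0) [IsFiniteMeasure m]
    (t : ℝ≥0) (x : X) : T t (average hT m x) = average hT m (T t x) := by
  rw [average_apply, average_apply, ← (T t).integral_comp_comm (hT.integrable m x)]
  simp only [hT.commute t]

theorem average_comm (hT : IsBoundedC0Semigroup T) (m n : Measure ℝ≥0) [IsFiniteMeasure m]
    [IsFiniteMeasure n] (x : X) :
    average hT m (average hT n x) = average hT n (average hT m x) := by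
  rw [average_apply hT n, ← (average hT m).integral_comp_comm (hT.integrable n x),
    average_apply hT n]
  simp only [average_comm_semigroup]

theorem average_dirac (hT : IsBoundedC0Semigroup T) (x : X) :
    average hT (Measure.dirac 0) x = x := by
  rw [average_apply, integral_dirac, hT.map_zero, one_apply_eq_self]

omit [CompleteSpace X] in
theorem average_add (hT : IsBoundedC0Semigroup T) (m n : Measure ℝ≥0) [IsFiniteMeasure m]
    [IsFiniteMeasure n] (x : X) : average hT (m + n) x = average hT m x + average hT n x := by
  simp only [average_apply]
  exact integral_add_measure (hT.integrable m x) (hT.integrable n x)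

theorem average_conv (hT : IsBoundedC0Semigroup T) (m n : Measure ℝ≥0) [IsFiniteMeasure m]
    [IsFiniteMeasure n] (x : X) :
    average hT (m.conv n) x = average hT m (average hT n x) := by
  simp only [average_apply]
  rw [integral_conv (hT.integrable _ x)]
  refine integral_congr_ae (Eventually.of_forall fun s => ?_)
  simp only [hT.map_add, mul_apply_eq_comp]
  exact (T s).integral_comp_comm (hT.integrable n x)

end Averages

/-! ### Laplace transforms of finite positive measures. -/

/-- The Laplace transform `z ↦ ∫ e^{-sz} m(ds)` of a positive measure. -/
noncomputable def expIntegral (m : Measure ℝ≥0) (z : ℂ) : ℂ :=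
  ∫ s : ℝ≥0, Complex.exp (-((s : ℝ) : ℂ) * z) ∂m

theorem norm_exp_neg_mul_le (s : ℝ≥0) {z : ℂ} (hz : 0 ≤ z.re) :
    ‖Complex.exp (-((s : ℝ) : ℂ) * z)‖ ≤ 1 := by
  rw [Complex.norm_exp, Real.exp_le_one_iff]
  have : (-((s : ℝ) : ℂ) * z).re = -(s * z.re) := by simp
  rw [this]
  have := mul_nonneg s.2 hz
  simpa using this

theorem integrable_exp_neg_mul (m : Measure ℝ≥0) [IsFiniteMeasure m] {z : ℂ} (hz : 0 ≤ z.re) :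
    Integrable (fun s : ℝ≥0 => Complex.exp (-((s : ℝ) : ℂ) * z)) m :=
  Integrable.of_bound (by fun_prop) 1 (Eventually.of_forall fun s => norm_exp_neg_mul_le s hz)

theorem expIntegral_dirac (z : ℂ) : expIntegral (Measure.dirac 0) z = 1 := by
  simp [expIntegral]

theorem expIntegral_add (m n : Measure ℝ≥0) [IsFiniteMeasure m] [IsFiniteMeasure n] {z : ℂ}
    (hz : 0 ≤ z.re) : expIntegral (m + n) z = expIntegral m z + expIntegral n z :=
  integral_add_measure (integrable_exp_neg_mul m hz) (integrable_exp_neg_mul n hz)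

theorem expIntegral_conv (m n : Measure ℝ≥0) [IsFiniteMeasure m] [IsFiniteMeasure n] {z : ℂ}
    (hz : 0 ≤ z.re) : expIntegral (m.conv n) z = expIntegral m z * expIntegral n z := by
  simp only [expIntegral]
  rw [integral_conv (integrable_exp_neg_mul _ hz), ← integral_mul_const]
  refine integral_congr_ae (Eventually.of_forall fun s => ?_)
  simp only
  rw [← integral_const_mul]
  refine integral_congr_ae (Eventually.of_forall fun r => ?_)
  simp only [← Complex.exp_add]
  congr 1
  push_cast
  ring

theorem differentiableOn_expIntegral (m : Measure ℝ≥0) [IsFiniteMeasure m] :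
    DifferentiableOn ℂ (expIntegral m) {z : ℂ | 0 < z.re} := by
  have hset : Set.Iio (0 : ℝ) ⊆
      ProbabilityTheory.integrableExpSet (fun s : ℝ≥0 => (s : ℝ)) m := by
    intro t ht
    refine Integrable.of_bound (by fun_prop) 1 (Eventually.of_forall fun s => ?_)
    rw [Real.norm_eq_abs, Real.abs_exp, Real.exp_le_one_iff]
    exact mul_nonpos_of_nonpos_of_nonneg (le_of_lt ht) s.2
  have hd := ProbabilityTheory.differentiableOn_complexMGF (X := fun s : ℝ≥0 => (s : ℝ)) (μ := m)
  have h1 : DifferentiableOn ℂ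
      (fun z : ℂ => ProbabilityTheory.complexMGF (fun s : ℝ≥0 => (s : ℝ)) m (-z))
      {z : ℂ | 0 < z.re} := by
    refine hd.comp (by fun_prop) fun z hz => ?_
    refine interior_maximal hset isOpen_Iio ?_
    simpa using hz
  refine h1.congr fun z _ => ?_
  simp only [expIntegral, ProbabilityTheory.complexMGF]
  refine integral_congr_ae (Eventually.of_forall fun s => ?_)
  simp only
  congr 1
  ring

/-! ### Functional calculus for differences of positive measures. -/

section Represents

variable {X : Type*} [NormedAddCommGroup X] [NormedSpace ℂ X] {T : ℝ≥0 → X →L[ℂ] X}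

/-- On the closed right half-plane without `0`, the function `g` is the Laplace transform of a
difference of finite measures, and `B` is the average of the semigroup against that difference. -/
def Represents (hT : IsBoundedC0Semigroup T) (g : ℂ → ℂ) (B : X →L[ℂ] X) : Prop :=
  ∃ (m n : Measure ℝ≥0) (_ : IsFiniteMeasure m) (_ : IsFiniteMeasure n),
    (∀ z : ℂ, 0 ≤ z.re → z ≠ 0 → g z = expIntegral m z - expIntegral n z) ∧
      B = average hT m - average hT n

variable {hT : IsBoundedC0Semigroup T} {g h : ℂ → ℂ} {B C : X →L[ℂ] X}

theorem Represents.congr (hg : Represents hT g B)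
    (hgh : ∀ z : ℂ, 0 ≤ z.re → z ≠ 0 → h z = g z) : Represents hT h B := by
  obtain ⟨m, n, hm, hn, h1, h2⟩ := hg
  exact ⟨m, n, hm, hn, fun z hz hz0 => (hgh z hz hz0).trans (h1 z hz hz0), h2⟩

theorem represents_of_measure (m : Measure ℝ≥0) [IsFiniteMeasure m]
    (hg : ∀ z : ℂ, 0 ≤ z.re → z ≠ 0 → g z = expIntegral m z) :
    Represents hT g (average hT m) := by
  refine ⟨m, 0, inferInstance, inferInstance, fun z hz hz0 => ?_, ?_⟩
  · rw [hg z hz hz0, expIntegral, expIntegral, integral_zero_measure, sub_zero]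
  · ext x
    simp [average_apply]

theorem Represents.neg (hg : Represents hT g B) : Represents hT (fun z => -g z) (-B) := by
  obtain ⟨m, n, hm, hn, h1, rfl⟩ := hg
  refine ⟨n, m, hn, hm, fun z hz hz0 => ?_, by abel⟩
  simp only [h1 z hz hz0]
  ring

theorem Represents.add (hg : Represents hT g B) (hh : Represents hT h C) :
    Represents hT (fun z => g z + h z) (B + C) := by
  obtain ⟨m, n, hm, hn, h1, rfl⟩ := hg
  obtain ⟨m', n', hm', hn', h1', rfl⟩ := hh
  refine ⟨m + m', n + n', inferInstance, inferInstance, fun z hz hz0 => ?_, ?_⟩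
  · simp only [h1 z hz hz0, h1' z hz hz0, expIntegral_add _ _ hz]
    ring
  · ext x
    simp only [add_apply, sub_apply, average_add]
    abel

theorem Represents.sub (hg : Represents hT g B) (hh : Represents hT h C) :
    Represents hT (fun z => g z - h z) (B - C) := by
  simpa only [sub_eq_add_neg] using hg.add hh.neg

variable [CompleteSpace X]

theorem represents_one : Represents hT (fun _ => 1) 1 := by
  have h1 : average hT (Measure.dirac 0) = 1 := by
    ext x
    simp [average_dirac]
  rw [← h1]
  exact represents_of_measure _ fun z _ _ => (expIntegral_dirac z).symm

theorem Represents.mul (hg : Represents hT g B) (hh : Represents hT h C) :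
    Represents hT (fun z => g z * h z) (B * C) := by
  obtain ⟨m, n, hm, hn, h1, rfl⟩ := hg
  obtain ⟨m', n', hm', hn', h1', rfl⟩ := hh
  refine ⟨m.conv m' + n.conv n', m.conv n' + n.conv m', inferInstance, inferInstance,
    fun z hz hz0 => ?_, ?_⟩
  · simp only [h1 z hz hz0, h1' z hz hz0, expIntegral_add _ _ hz, expIntegral_conv _ _ hz]
    ring
  · ext x
    simp only [mul_apply_eq_comp, sub_apply, average_add,
      average_conv, map_sub]
    abel

theorem Represents.commute (hg : Represents hT g B) (hh : Represents hT h C) (x : X) :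
    B (C x) = C (B x) := by
  obtain ⟨m, n, hm, hn, h1, rfl⟩ := hg
  obtain ⟨m', n', hm', hn', h1', rfl⟩ := hh
  simp only [sub_apply, map_sub, average_comm hT m m', average_comm hT n m',
    average_comm hT m n', average_comm hT n n']
  abel

omit [CompleteSpace X] in
theorem Represents.differentiableOn (hg : Represents hT g B) :
    DifferentiableOn ℂ g {z : ℂ | 0 < z.re} := by
  obtain ⟨m, n, hm, hn, h1, -⟩ := hg
  refine ((differentiableOn_expIntegral m).sub (differentiableOn_expIntegral n)).congr
    fun z hz => h1 z (le_of_lt hz) ?_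
  rintro rfl
  simp at hz

end Represents

/-! ### Passage to complex measures. -/

section ComplexMeasure

/-- A finite measure as a complex measure. -/
noncomputable def complexOfFinite (m : Measure ℝ≥0) [IsFiniteMeasure m] : ComplexMeasure ℝ≥0 :=
  m.toSignedMeasure.toComplexMeasure 0

theorem complexOfFinite_apply (m : Measure ℝ≥0) [IsFiniteMeasure m] {s : Set ℝ≥0}
    (hs : MeasurableSet s) : complexOfFinite m s = ((m.real s : ℝ) : ℂ) := by
  rw [complexOfFinite, SignedMeasure.toComplexMeasure_apply,
    Measure.toSignedMeasure_apply_measurable hs]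
  apply Complex.ext <;> simp

theorem variation_complexOfFinite (m : Measure ℝ≥0) [IsFiniteMeasure m] :
    (complexOfFinite m).variation = m := by
  have key : ∀ s, MeasurableSet s → ‖complexOfFinite m s‖ₑ = m s := by
    intro s hs
    rw [complexOfFinite_apply m hs, ← ofReal_norm, Complex.norm_real, Real.norm_eq_abs,
      abs_of_nonneg measureReal_nonneg, measureReal_def, ENNReal.ofReal_toReal (measure_ne_top m s)]
  refine le_antisymm ?_ ?_
  · exact VectorMeasure.variation_le_of_forall_enorm_le fun s hs => (key s hs).le
  · refine Measure.le_iff.2 fun s hs => ?_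
    rw [← key s hs]
    exact VectorMeasure.enorm_measure_le_variation _ _

/-- Sets have real mass, so the pairing `L` matters only on real scalars. This covers both the
multiplication in `laplace` and the scalar action in `hillePhillips`. -/
theorem integral_complexOfFinite {E : Type*} [NormedAddCommGroup E] [NormedSpace ℝ E]
    (m : Measure ℝ≥0) [IsFiniteMeasure m] (φ : ℝ≥0 → E) (L : E →L[ℝ] ℂ →L[ℝ] E)
    (hL : ∀ (x : E) (r : ℝ), L x (r : ℂ) = r • x) :
    VectorMeasure.integral (complexOfFinite m) φ L = ∫ s, φ s ∂m := by
  rw [VectorMeasure.integral_eq_setToFun, MeasureTheory.integral_eq_setToFun]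
  simp only [variation_complexOfFinite]
  apply setToFun_congr_left' _ _ (fun s hs _ => ?_)
  ext x
  change L x (complexOfFinite m s) = _
  rw [complexOfFinite_apply m hs, hL, weightedSMul_apply]

theorem integral_complexOfFinite_sub {E : Type*} [NormedAddCommGroup E] [NormedSpace ℝ E]
    (m n : Measure ℝ≥0) [IsFiniteMeasure m] [IsFiniteMeasure n] {φ : ℝ≥0 → E}
    (L : E →L[ℝ] ℂ →L[ℝ] E) (hL : ∀ (x : E) (r : ℝ), L x (r : ℂ) = r • x)
    (hm : Integrable φ m) (hn : Integrable φ n) :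
    VectorMeasure.integral (complexOfFinite m - complexOfFinite n) φ L =
      ∫ s, φ s ∂m - ∫ s, φ s ∂n := by
  rw [VectorMeasure.integral_sub_vectorMeasure, integral_complexOfFinite m φ L hL,
    integral_complexOfFinite n φ L hL]
  · rwa [VectorMeasure.Integrable, variation_complexOfFinite]
  · rwa [VectorMeasure.Integrable, variation_complexOfFinite]

variable {X : Type*} [NormedAddCommGroup X] [NormedSpace ℂ X] {T : ℝ≥0 → X →L[ℂ] X}
  {hT : IsBoundedC0Semigroup T} {g : ℂ → ℂ} {B : X →L[ℂ] X}

theorem Represents.exists_complexMeasure (hg : Represents hT g B) :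
    ∃ μ : ComplexMeasure ℝ≥0, (∀ z : ℂ, 0 < z.re → laplace μ z = g z) ∧ hillePhillips T μ = B := by
  obtain ⟨m, n, hm, hn, h1, rfl⟩ := hg
  refine ⟨complexOfFinite m - complexOfFinite n, fun z hz => ?_, ?_⟩
  · have hz0 : z ≠ 0 := by
      rintro rfl
      simp at hz
    rw [h1 z hz.le hz0, laplace, integral_complexOfFinite_sub m n _ _
      (integrable_exp_neg_mul m hz.le) (integrable_exp_neg_mul n hz.le)]
    · rfl
    · intro x r
      simp [mul_comm]
  · ext x
    rw [hillePhillips, integral_complexOfFinite_sub m n _ _ (hT.integrable m x)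
      (hT.integrable n x)]
    · rfl
    · intro x r
      simp

end ComplexMeasure

/-! ### Exponential densities. -/

/-- The measure `e^{-rs} ds` on `[0, ∞)`. -/
noncomputable def expDensity (r : ℝ) : Measure ℝ≥0 :=
  ((volume.restrict (Set.Ioi (0 : ℝ))).withDensity
    (fun s => ENNReal.ofReal (Real.exp (-r * s)))).map Real.toNNReal

theorem isFiniteMeasure_expDensity {r : ℝ} (hr : 0 < r) : IsFiniteMeasure (expDensity r) := by
  have h := (exp_neg_integrableOn_Ioi 0 hr)
  have : IsFiniteMeasure ((volume.restrict (Set.Ioi (0 : ℝ))).withDensity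
      (fun s => ENNReal.ofReal (Real.exp (-r * s)))) :=
    isFiniteMeasure_withDensity_ofReal h.2
  rw [expDensity]
  infer_instance

theorem integral_expDensity {E : Type*} [NormedAddCommGroup E] [NormedSpace ℝ E] (r : ℝ)
    {φ : ℝ≥0 → E} (hφ : StronglyMeasurable φ) :
    ∫ s, φ s ∂(expDensity r) = ∫ s in Set.Ioi (0 : ℝ), Real.exp (-r * s) • φ s.toNNReal := by
  rw [expDensity, integral_map (by fun_prop) hφ.aestronglyMeasurable,
    integral_withDensity_eq_integral_toReal_smul (by fun_prop) (by simp)]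
  simp only [ENNReal.toReal_ofReal (Real.exp_pos _).le]

theorem expIntegral_expDensity {r : ℝ} (hr : 0 < r) {z : ℂ} (hz : 0 ≤ z.re) :
    expIntegral (expDensity r) z = (z + r)⁻¹ := by
  have hre : (-(z + r)).re < 0 := by
    simp only [Complex.neg_re, Complex.add_re, Complex.ofReal_re]
    linarith
  have h := integral_exp_mul_complex_Ioi hre 0
  rw [expIntegral, integral_expDensity r (by fun_prop : Continuous _).stronglyMeasurable]
  have h2 : ∀ s ∈ Set.Ioi (0 : ℝ), Real.exp (-r * s) •
      Complex.exp (-((s.toNNReal : ℝ) : ℂ) * z) = Complex.exp (-(z + r) * s) := by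
    intro s hs
    rw [Real.coe_toNNReal _ (le_of_lt hs), Complex.real_smul, Complex.ofReal_exp,
      ← Complex.exp_add]
    congr 1
    push_cast
    ring
  rw [setIntegral_congr_fun measurableSet_Ioi h2, h, Complex.ofReal_zero, mul_zero,
    Complex.exp_zero, neg_div_neg_eq, one_div]

/-! ### Resolvents and approximate eigenvectors. -/

section Resolvent

variable {X : Type*} [NormedAddCommGroup X] [NormedSpace ℂ X] {T : ℝ≥0 → X →L[ℂ] X}

theorem IsBoundedC0Semigroup.continuous_exp_smul (hT : IsBoundedC0Semigroup T) (l : ℂ) (x : X) :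
    Continuous (fun s : ℝ => Complex.exp (-l * s) • T s.toNNReal x) := by
  have := (hT.continuous x).comp continuous_real_toNNReal
  exact (by fun_prop : Continuous fun s : ℝ => Complex.exp (-l * s)).smul this

theorem norm_exp_smul_le {M : ℝ} (hM : ∀ t x, ‖T t x‖ ≤ M * ‖x‖) (l : ℂ) (x : X) (s : ℝ) :
    ‖Complex.exp (-l * s) • T s.toNNReal x‖ ≤ M * ‖x‖ * Real.exp (-l.re * s) := by
  rw [norm_smul, Complex.norm_exp]
  have : (-l * s).re = -l.re * s := by simp
  rw [this, mul_comm]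
  gcongr
  exact hM _ _

theorem IsBoundedC0Semigroup.integrableOn_exp_smul (hT : IsBoundedC0Semigroup T) {l : ℂ}
    (hl : 0 < l.re) (x : X) :
    IntegrableOn (fun s : ℝ => Complex.exp (-l * s) • T s.toNNReal x) (Set.Ioi 0) := by
  obtain ⟨M, -, hM⟩ := hT.exists_bound
  exact Integrable.mono' ((exp_neg_integrableOn_Ioi 0 hl).const_mul (M * ‖x‖))
    (hT.continuous_exp_smul l x).aestronglyMeasurable
    (Eventually.of_forall fun s => norm_exp_smul_le hM l x s)

theorem norm_integral_exp_smul_le {M : ℝ} (hM : ∀ t x, ‖T t x‖ ≤ M * ‖x‖) {l : ℂ}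
    (hl : 0 < l.re) (x : X) :
    ‖∫ s in Set.Ioi (0 : ℝ), Complex.exp (-l * s) • T s.toNNReal x‖ ≤ M / l.re * ‖x‖ := by
  refine (norm_integral_le_of_norm_le ((exp_neg_integrableOn_Ioi 0 hl).const_mul (M * ‖x‖))
    (Eventually.of_forall fun s => norm_exp_smul_le hM l x s)).trans (le_of_eq ?_)
  rw [integral_const_mul, integral_exp_mul_Ioi (by linarith)]
  simp
  field_simp

/-- The resolvent `(l + A)⁻¹ x = ∫ e^{-ls} T s x ds` of a bounded semigroup, for `Re l > 0`. -/
noncomputable def resolventOf (hT : IsBoundedC0Semigroup T) {l : ℂ} (hl : 0 < l.re) : X →L[ℂ] X :=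
  LinearMap.mkContinuousOfExistsBound
    { toFun := fun x => ∫ s in Set.Ioi (0 : ℝ), Complex.exp (-l * s) • T s.toNNReal x
      map_add' := fun x y => by
        simp only [map_add, smul_add]
        exact integral_add (hT.integrableOn_exp_smul hl x) (hT.integrableOn_exp_smul hl y)
      map_smul' := fun c x => by
        simp only [map_smul, RingHom.id_apply]
        simp_rw [smul_comm _ c]
        exact integral_smul c _ }
    (by
      obtain ⟨M, -, hM⟩ := hT.exists_bound
      exact ⟨M / l.re, fun x => norm_integral_exp_smul_le hM hl x⟩)

theorem resolventOf_apply (hT : IsBoundedC0Semigroup T) {l : ℂ} (hl : 0 < l.re) (x : X) :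
    resolventOf hT hl x = ∫ s in Set.Ioi (0 : ℝ), Complex.exp (-l * s) • T s.toNNReal x := rfl

theorem resolventOf_real (hT : IsBoundedC0Semigroup T) {r : ℝ} (hr : 0 < r)
    [IsFiniteMeasure (expDensity r)] :
    resolventOf hT (l := (r : ℂ)) (by simpa using hr) = average hT (expDensity r) := by
  ext x
  rw [resolventOf_apply, average_apply, integral_expDensity r (hT.continuous x).stronglyMeasurable]
  refine integral_congr_ae (Eventually.of_forall fun s => ?_)
  simp only
  rw [← Complex.coe_smul, Complex.ofReal_exp]
  push_cast
  rfl

variable [CompleteSpace X]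

/-- Shifting the variable by t turns the integral over (0, ∞) into e^{lt} times the integral over
(t, ∞). -/
theorem semigroup_resolventOf (hT : IsBoundedC0Semigroup T) {l : ℂ} (hl : 0 < l.re) (x : X)
    (t : ℝ≥0) :
    T t (resolventOf hT hl x) = Complex.exp (l * (t : ℝ)) •
      (resolventOf hT hl x - ∫ s in (0 : ℝ)..t, Complex.exp (-l * s) • T s.toNNReal x) := by
  set F : ℝ → X := fun s => Complex.exp (-l * s) • T s.toNNReal x with hF
  have hint := hT.integrableOn_exp_smul hl x
  have h1 : T t (resolventOf hT hl x) = ∫ s in Set.Ioi (0 : ℝ),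
      Complex.exp (l * (t : ℝ)) • F (s + t) := by
    rw [resolventOf_apply, ← (T t).integral_comp_comm hint]
    refine setIntegral_congr_fun measurableSet_Ioi fun s hs => ?_
    simp only [hF]
    rw [map_smul, smul_smul, ← Complex.exp_add, ← mul_apply_eq_comp, ← hT.map_add,
      Real.toNNReal_add (le_of_lt hs) t.coe_nonneg, Real.toNNReal_coe, add_comm t]
    congr 2
    push_cast
    ring
  have h2 : ∫ s in Set.Ioi (0 : ℝ), F (s + t) = ∫ s in Set.Ioi (t : ℝ), F s := by
    have := (measurePreserving_add_right (volume : Measure ℝ) (t : ℝ)).setIntegral_preimage_emb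
      (measurableEmbedding_addRight (t : ℝ)) F (Set.Ioi (t : ℝ))
    simpa using this
  have h3 := intervalIntegral.integral_interval_add_Ioi hint
    (hint.mono_set (Set.Ioi_subset_Ioi t.coe_nonneg))
  rw [h1, integral_smul, h2, resolventOf_apply, ← h3, add_sub_cancel_left]

theorem semigroup_resolventOf_comm (hT : IsBoundedC0Semigroup T) {l : ℂ} (hl : 0 < l.re) (x : X)
    (t : ℝ≥0) : T t (resolventOf hT hl x) = resolventOf hT hl (T t x) := by
  rw [resolventOf_apply, resolventOf_apply,
    ← (T t).integral_comp_comm (hT.integrableOn_exp_smul hl x)]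
  simp only [map_smul, hT.commute t]

/-- This is minus the derivative at 0 of the formula in `semigroup_resolventOf`. It shows that the
Laplace integral lands in the domain of A. -/
theorem tendsto_resolventOf (hT : IsBoundedC0Semigroup T) {l : ℂ} (hl : 0 < l.re) (x : X) :
    Tendsto (fun t : ℝ≥0 => ((t : ℝ) : ℂ)⁻¹ •
      (resolventOf hT hl x - T t (resolventOf hT hl x))) (𝓝[>] 0)
      (𝓝 (x - l • resolventOf hT hl x)) := by
  set y := resolventOf hT hl x with hy
  have hcont := hT.continuous_exp_smul l x
  have hd1 : HasDerivAt (fun t : ℝ => ∫ s in (0 : ℝ)..t, Complex.exp (-l * s) • T s.toNNReal x)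
      x 0 := by
    have := intervalIntegral.integral_hasDerivAt_right (hcont.intervalIntegrable 0 0)
      (hcont.stronglyMeasurableAtFilter _ _) hcont.continuousAt
    simpa [hT.map_zero] using this
  have hd2 : HasDerivAt (fun t : ℝ => Complex.exp (l * t)) l 0 := by
    have h0 : HasDerivAt (fun t : ℝ => l * (t : ℂ)) (l * 1) 0 :=
      (Complex.ofRealCLM.hasDerivAt).const_mul l
    simpa using h0.cexp
  have hd3 := hd2.smul ((hasDerivAt_const (0 : ℝ) y).sub hd1)
  have hs := hd3.tendsto_slope_zero_right
  have hcoe : Tendsto (fun t : ℝ≥0 => (t : ℝ)) (𝓝[>] 0) (𝓝[>] 0) := by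
    refine tendsto_nhdsWithin_iff.2 ⟨?_, ?_⟩
    · exact (NNReal.continuous_coe.tendsto 0).mono_left nhdsWithin_le_nhds
    · exact eventually_nhdsWithin_of_forall fun t ht => by simpa using ht
  have hs2 := (hs.comp hcoe).neg
  simp only [Pi.sub_apply, Pi.smul_apply', intervalIntegral.integral_same, Complex.ofReal_zero, mul_zero,
    Complex.exp_zero, sub_zero, zero_sub, smul_neg, one_smul] at hs2
  have hlim : -(-x + l • y) = x - l • y := by abel
  rw [hlim] at hs2
  refine hs2.congr fun t => ?_
  simp only [Function.comp_apply, zero_add]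
  rw [semigroup_resolventOf hT hl x t, ← hy, ← Complex.ofReal_inv, Complex.coe_smul,
    ← smul_neg, neg_sub]

variable {A : X →ₗ.[ℂ] X}

theorem isBoundedInverse_resolventOf (hT : IsBoundedC0Semigroup T) (hA : IsNegGenerator T A)
    {l : ℂ} (hl : 0 < l.re) : IsBoundedInverse A l 1 (resolventOf hT hl) := by
  refine ⟨fun y => ?_, fun x => ?_⟩
  · have h := (hA _ _).2 (tendsto_resolventOf hT hl y)
    rw [LinearPMap.mem_graph_iff] at h
    obtain ⟨w, hw1, hw2⟩ := h
    have hmem : resolventOf hT hl y ∈ A.domain := by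
      have := w.2
      rwa [hw1] at this
    refine ⟨hmem, ?_⟩
    have : w = ⟨resolventOf hT hl y, hmem⟩ := Subtype.ext hw1
    rw [← this, hw2]
    simp
  · have h := (hA _ _).1 (A.mem_graph x)
    have h2 := ((resolventOf hT hl).continuous.tendsto _).comp h
    have h3 := tendsto_resolventOf hT hl (x : X)
    -- The resolvent commutes with the semigroup, so it maps the difference quotients of x to those
    -- of its image; both limits must agree.
    have h4 : resolventOf hT hl (A x) = x - l • resolventOf hT hl x := by
      refine tendsto_nhds_unique h2 (h3.congr fun t => ?_)
      simp only [Function.comp_apply, map_smul, map_sub, semigroup_resolventOf_comm]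
    rw [one_smul, map_add, map_smul, h4]
    abel

omit [CompleteSpace X] in
theorem IsBoundedInverse.unique {a b : ℂ} {R S : X →L[ℂ] X} (hR : IsBoundedInverse A a b R)
    (hS : IsBoundedInverse A a b S) : R = S := by
  ext y
  obtain ⟨h, hy⟩ := hS.1 y
  have := hR.2 ⟨S y, h⟩
  rw [hy] at this
  exact this

theorem backwardStep_eq (hT : IsBoundedC0Semigroup T) (hA : IsNegGenerator T A) {h : ℝ}
    (hh : 0 < h) [IsFiniteMeasure (expDensity h⁻¹)] :
    backwardStep A h = ((h : ℂ)⁻¹) • average hT (expDensity h⁻¹) := by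
  have hne : (h : ℂ) ≠ 0 := by exact_mod_cast hh.ne'
  have hinv : IsBoundedInverse A 1 (h : ℂ) ((h : ℂ)⁻¹ • average hT (expDensity h⁻¹)) := by
    rw [← resolventOf_real hT (inv_pos.2 hh)]
    obtain ⟨h1, h2⟩ := isBoundedInverse_resolventOf hT hA
      (l := ((h⁻¹ : ℝ) : ℂ)) (by simpa using hh)
    refine ⟨fun y => ?_, fun x => ?_⟩
    · obtain ⟨hm, hy⟩ := h1 y
      refine ⟨A.domain.smul_mem _ hm, ?_⟩
      have : A ⟨((h : ℂ)⁻¹ • resolventOf hT _) y, A.domain.smul_mem _ hm⟩ = (h : ℂ)⁻¹ •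
          A ⟨resolventOf hT _ y, hm⟩ := A.map_smul (h : ℂ)⁻¹ ⟨_, hm⟩
      rw [this, smul_smul, mul_inv_cancel₀ hne, one_smul]
      rw [one_smul] at hy ⊢
      convert hy using 2
      simp
    · have h3 := h2 x
      rw [smul_apply, ← map_smul, smul_add, smul_smul, smul_smul, inv_mul_cancel₀ hne,
        mul_one, ← Complex.ofReal_inv]
      exact h3
  have hex : ∃ R : X →L[ℂ] X, IsBoundedInverse A 1 (h : ℂ) R := ⟨_, hinv⟩
  rw [backwardStep, dif_pos hex]
  exact hex.choose_spec.unique hinv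

/-- Neumann series: with R = (d - iw + A)⁻¹ and ‖dR‖ < 1, the factorization iw - A = -(1 - dR)(d -
iw + A) would be boundedly invertible, contrary to iw being in the spectrum. -/
theorem inv_le_norm_resolventOf (hT : IsBoundedC0Semigroup T) (hA : IsNegGenerator T A)
    {w d : ℝ} (hw : (w : ℂ) * Complex.I ∈ opSpectrum A) (hd : 0 < d)
    (hl : 0 < ((d : ℂ) - w * Complex.I).re) : d⁻¹ ≤ ‖resolventOf hT hl‖ := by
  by_contra! hlt
  set R := resolventOf hT hl with hR
  obtain ⟨h1, h2⟩ := isBoundedInverse_resolventOf hT hA hl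
  rw [← hR] at h1 h2
  have hnorm : ‖(d : ℂ) • R‖ < 1 := by
    rw [norm_smul, Complex.norm_real, Real.norm_eq_abs, abs_of_pos hd]
    calc d * ‖R‖ < d * d⁻¹ := by gcongr
      _ = 1 := mul_inv_cancel₀ hd.ne'
  set u := Units.oneSub ((d : ℂ) • R) hnorm with hu
  have hval : (u : X →L[ℂ] X) = 1 - (d : ℂ) • R := rfl
  set V : X →L[ℂ] X := ((u⁻¹ : (X →L[ℂ] X)ˣ) : X →L[ℂ] X) with hV
  have hcomm : Commute R V := by
    have : Commute R (u : X →L[ℂ] X) := by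
      rw [hval]
      exact (Commute.one_right R).sub_right ((Commute.refl R).smul_right _)
    exact this.units_inv_right
  have huV : ∀ y, V y - (d : ℂ) • R (V y) = y := by
    intro y
    have : ((u : X →L[ℂ] X) * V) y = y := by rw [hV, Units.mul_inv, one_apply_eq_self]
    simpa [hval, mul_apply_eq_comp] using this
  have hVu : ∀ y, V (y - (d : ℂ) • R y) = y := by
    intro y
    have : (V * (u : X →L[ℂ] X)) y = y := by rw [hV, Units.inv_mul, one_apply_eq_self]
    simpa [hval, mul_apply_eq_comp] using this
  refine hw ⟨-(R * V), fun y => ?_, fun x => ?_⟩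
  · obtain ⟨hm, hy⟩ := h1 (V y)
    refine ⟨A.domain.neg_mem hm, ?_⟩
    have hneg : A ⟨(-(R * V)) y, A.domain.neg_mem hm⟩ = -A ⟨R (V y), hm⟩ :=
      A.map_neg ⟨_, hm⟩
    rw [hneg]
    have h3 := huV y
    rw [one_smul] at hy
    have h4 : A ⟨R (V y), hm⟩ = V y - ((d : ℂ) - w * Complex.I) • R (V y) := by
      rw [eq_sub_iff_add_eq']
      exact hy
    rw [h4]
    simp only [neg_apply, mul_apply_eq_comp]
    -- Only the isolated `y` on the right-hand side is expanded.
    nth_rewrite 4 [← h3]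
    module
  · have h3 := h2 x
    have hx : (((w : ℂ) * Complex.I) • (x : X) + (-1 : ℂ) • A x) =
        -((((d : ℂ) - w * Complex.I) • (x : X) + (1 : ℂ) • A x) - (d : ℂ) • (x : X)) := by
      module
    rw [hcomm.eq, hx, map_neg, neg_apply, neg_neg, mul_apply_eq_comp, map_sub, h3, map_smul]
    exact hVu x

/-- As d → 0 the resolvent R at d - iw blows up, so there are unit vectors z = Ry with ‖y‖ ≤ 2d. In
T t z = e^{(d-iw)t}(z - ∫₀ᵗ …) the integral is then O(d), which leaves e^{-iwt} z in the limit. -/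
theorem exists_approximate_eigenvectors (hT : IsBoundedC0Semigroup T) (hA : IsNegGenerator T A)
    {w : ℝ} (hw : (w : ℂ) * Complex.I ∈ opSpectrum A) :
    ∃ v : ℕ → X, (∀ k, ‖v k‖ = 1) ∧ ∀ t : ℝ≥0, Tendsto
      (fun k => T t (v k) - Complex.exp (-((t : ℝ) : ℂ) * (w * Complex.I)) • v k) atTop (𝓝 0) := by
  obtain ⟨M, hM0, hM⟩ := hT.exists_bound
  set d : ℕ → ℝ := fun k => 1 / ((k : ℝ) + 1) with hd
  have hdpos : ∀ k, 0 < d k := fun k => by positivity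
  have hl : ∀ k, 0 < ((d k : ℂ) - w * Complex.I).re := fun k => by simpa using hdpos k
  -- The norm of the resolvent is at least 1/d but need not be attained; the factor 2 gives the
  -- room.
  have hy : ∀ k, ∃ y : X, ‖y‖ ≤ 2 * d k * ‖resolventOf hT (hl k) y‖ ∧
      resolventOf hT (hl k) y ≠ 0 := by
    intro k
    by_contra! hcon
    have hle : ‖resolventOf hT (hl k)‖ ≤ (2 * d k)⁻¹ := by
      have hdk := hdpos k
      refine ContinuousLinearMap.opNorm_le_bound _ (by positivity) fun y => ?_
      by_cases h : ‖y‖ ≤ 2 * d k * ‖resolventOf hT (hl k) y‖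
      · rw [hcon y h, norm_zero]
        positivity
      · rw [inv_mul_eq_div, le_div_iff₀ (by positivity)]
        linarith
    have h1 := (inv_le_norm_resolventOf hT hA hw (hdpos k) (hl k)).trans hle
    rw [mul_inv] at h1
    have := inv_pos.2 (hdpos k)
    linarith
  choose y hy1 hy2 using hy
  refine ⟨fun k => ((‖resolventOf hT (hl k) (y k)‖ : ℂ)⁻¹) • resolventOf hT (hl k) (y k),
    fun k => ?_, fun t => ?_⟩
  · rw [norm_smul, norm_inv, Complex.norm_real, norm_norm,
      inv_mul_cancel₀ (norm_ne_zero_iff.2 (hy2 k))]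
  have hbound : ∀ k, ‖T t (((‖resolventOf hT (hl k) (y k)‖ : ℂ)⁻¹) • resolventOf hT (hl k) (y k)) -
      Complex.exp (-((t : ℝ) : ℂ) * (w * Complex.I)) •
        (((‖resolventOf hT (hl k) (y k)‖ : ℂ)⁻¹) • resolventOf hT (hl k) (y k))‖ ≤
      (Real.exp (d k * t) - 1) + Real.exp (d k * t) * (M * (2 * d k) * t) := by
    intro k
    set z := resolventOf hT (hl k) (y k) with hz
    set J := ∫ s in (0 : ℝ)..t, Complex.exp (-((d k : ℂ) - w * Complex.I) * s) •
      T s.toNNReal (y k) with hJ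
    have hzpos : 0 < ‖z‖ := norm_pos_iff.2 (hy2 k)
    have hJle : ‖J‖ ≤ M * ‖y k‖ * t := by
      have := intervalIntegral.norm_integral_le_of_norm_le_const (a := 0) (b := (t : ℝ))
        (C := M * ‖y k‖)
        (f := fun s : ℝ => Complex.exp (-((d k : ℂ) - w * Complex.I) * s) • T s.toNNReal (y k)) ?_
      · rwa [sub_zero, abs_of_nonneg t.coe_nonneg] at this
      · intro s hs
        rw [Set.uIoc_of_le t.coe_nonneg] at hs
        refine (norm_exp_smul_le hM _ _ _).trans ?_
        refine mul_le_of_le_one_right (by positivity) ?_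
        rw [Real.exp_le_one_iff]
        have := mul_pos (hl k) hs.1
        linarith
    have hE : Complex.exp (((d k : ℂ) - w * Complex.I) * (t : ℝ)) =
        ((Real.exp (d k * t) : ℝ) : ℂ) * Complex.exp (-((t : ℝ) : ℂ) * (w * Complex.I)) := by
      rw [Complex.ofReal_exp, ← Complex.exp_add]
      congr 1
      push_cast
      ring
    have hdiff : T t z - Complex.exp (-((t : ℝ) : ℂ) * (w * Complex.I)) • z =
        Complex.exp (-((t : ℝ) : ℂ) * (w * Complex.I)) •
          ((((Real.exp (d k * t) - 1 : ℝ)) : ℂ) • z - ((Real.exp (d k * t) : ℝ) : ℂ) • J) := by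
      rw [hz, semigroup_resolventOf hT (hl k) (y k) t, ← hz, ← hJ, hE]
      push_cast
      module
    have hone : ‖Complex.exp (-((t : ℝ) : ℂ) * (w * Complex.I))‖ = 1 := by
      rw [Complex.norm_exp]
      simp
    have hge : 0 ≤ Real.exp (d k * t) - 1 := by
      exact sub_nonneg.2 (Real.one_le_exp (mul_nonneg (hdpos k).le t.coe_nonneg))
    have hle : ‖T t z - Complex.exp (-((t : ℝ) : ℂ) * (w * Complex.I)) • z‖ ≤
        ((Real.exp (d k * t) - 1) + Real.exp (d k * t) * (M * (2 * d k) * t)) * ‖z‖ := by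
      rw [hdiff, norm_smul, hone, one_mul]
      refine (norm_sub_le _ _).trans ?_
      rw [norm_smul, norm_smul, Complex.norm_real, Complex.norm_real, Real.norm_eq_abs,
        Real.norm_eq_abs, abs_of_nonneg hge, abs_of_pos (Real.exp_pos _), add_mul, mul_assoc]
      gcongr
      refine hJle.trans ?_
      calc M * ‖y k‖ * t ≤ M * (2 * d k * ‖z‖) * t := by
            gcongr
            exact hy1 k
        _ = M * (2 * d k) * t * ‖z‖ := by ring
    rw [map_smul, smul_comm (Complex.exp _), ← smul_sub, norm_smul, norm_inv, Complex.norm_real,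
      norm_norm, inv_mul_eq_div, div_le_iff₀ hzpos]
    exact hle
  have hd0 : Tendsto d atTop (𝓝 0) := tendsto_one_div_add_atTop_nhds_zero_nat
  have hc : Continuous fun r : ℝ =>
      (Real.exp (r * t) - 1) + Real.exp (r * t) * (M * (2 * r) * t) := by fun_prop
  have h0 := (hc.tendsto 0).comp hd0
  simp only [zero_mul, Real.exp_zero, sub_self, mul_zero, add_zero] at h0
  exact squeeze_zero_norm hbound h0

/-- Dominated convergence, with the constant bound M + 1 for unit vectors. -/
theorem tendsto_average_approximate_eigenvectors (hT : IsBoundedC0Semigroup T) {w : ℝ} {v : ℕ → X}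
    (hv : ∀ k, ‖v k‖ = 1) (hv2 : ∀ t : ℝ≥0, Tendsto
      (fun k => T t (v k) - Complex.exp (-((t : ℝ) : ℂ) * (w * Complex.I)) • v k) atTop (𝓝 0))
    (m : Measure ℝ≥0) [IsFiniteMeasure m] :
    Tendsto (fun k => average hT m (v k) - expIntegral m (w * Complex.I) • v k) atTop (𝓝 0) := by
  obtain ⟨M, hM0, hM⟩ := hT.exists_bound
  have hre : 0 ≤ ((w : ℂ) * Complex.I).re := by simp
  have h := tendsto_integral_of_dominated_convergence (μ := m) (f := fun _ => (0 : X))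
    (F := fun k s => T s (v k) - Complex.exp (-((s : ℝ) : ℂ) * (w * Complex.I)) • v k)
    (fun _ => M + 1) (fun k => ?_) (integrable_const _) (fun k => ?_)
    (Eventually.of_forall fun s => hv2 s)
  · rw [integral_zero] at h
    refine h.congr fun k => ?_
    rw [integral_sub (hT.integrable m _) ((integrable_exp_neg_mul m hre).smul_const _),
      integral_smul_const]
    rfl
  · exact ((hT.integrable m _).sub ((integrable_exp_neg_mul m hre).smul_const _)).1
  · refine Eventually.of_forall fun s => (norm_sub_le _ _).trans ?_
    refine add_le_add ?_ ?_
    · simpa [hv k] using hM s (v k)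
    · rw [norm_smul, hv k, mul_one]
      exact norm_exp_neg_mul_le s hre

end Resolvent

/-! ### The kernel 1/(z + t) on the closed right half-plane. -/

theorem norm_le_norm_add_coe {z : ℂ} (hz : 0 ≤ z.re) (t : ℝ≥0) :
    ‖z‖ ≤ ‖z + ((t : ℝ) : ℂ)‖ := by
  refine le_of_sq_le_sq ?_ (norm_nonneg _)
  rw [Complex.sq_norm, Complex.sq_norm, Complex.normSq_apply, Complex.normSq_apply]
  simp only [Complex.add_re, Complex.ofReal_re, Complex.add_im, Complex.ofReal_im, add_zero]
  nlinarith [mul_nonneg hz t.coe_nonneg, mul_nonneg t.coe_nonneg t.coe_nonneg]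

theorem coe_le_norm_add_coe {z : ℂ} (hz : 0 ≤ z.re) (t : ℝ≥0) :
    (t : ℝ) ≤ ‖z + ((t : ℝ) : ℂ)‖ := by
  refine le_trans ?_ (Complex.re_le_norm _)
  simpa using hz

theorem add_coe_ne_zero {z : ℂ} (hz : 0 ≤ z.re) (hz0 : z ≠ 0) (t : ℝ≥0) :
    z + ((t : ℝ) : ℂ) ≠ 0 :=
  norm_pos_iff.1 ((norm_pos_iff.2 hz0).trans_le (norm_le_norm_add_coe hz t))

theorem norm_inv_add_coe_le {z : ℂ} (hz : 0 ≤ z.re) (hz0 : z ≠ 0) (t : ℝ≥0) :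
    ‖(z + ((t : ℝ) : ℂ))⁻¹‖ ≤ (‖z‖⁻¹ + 1) * (1 + (t : ℝ))⁻¹ := by
  have h1 := norm_le_norm_add_coe hz t
  have h2 := coe_le_norm_add_coe hz t
  have h3 := norm_pos_iff.2 hz0
  have ht := t.coe_nonneg
  rw [norm_inv, inv_le_comm₀ (h3.trans_le h1) (by positivity), mul_inv, inv_inv]
  rw [inv_mul_le_iff₀ (by positivity), add_mul, one_mul]
  refine add_le_add ?_ h2
  rw [inv_mul_eq_div, le_div_iff₀ h3, one_mul]
  exact h1

theorem integrable_inv_add_coe {μ : Measure ℝ≥0}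
    (hμ : Integrable (fun t : ℝ≥0 => (1 + (t : ℝ))⁻¹) μ) {z : ℂ} (hz : 0 ≤ z.re) (hz0 : z ≠ 0) :
    Integrable (fun t : ℝ≥0 => (z + ((t : ℝ) : ℂ))⁻¹) μ :=
  (hμ.const_mul (‖z‖⁻¹ + 1)).mono' (by fun_prop)
    (Eventually.of_forall fun t => norm_inv_add_coe_le hz hz0 t)

theorem mem_slitPlane_of_re_nonneg {z : ℂ} (hz : 0 ≤ z.re) (hz0 : z ≠ 0) :
    z ∈ Complex.slitPlane := by
  rw [Complex.mem_slitPlane_iff]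
  rcases hz.lt_or_eq with h | h
  · exact Or.inl h
  · refine Or.inr fun him => hz0 (Complex.ext h.symm him)

/-- The function t/(z + t) is the Laplace transform of the exponential law of rate t, the law of u/t
for u exponential of rate 1. The required measure is the mixture of these laws over η. The rate 0 is
excluded because u/0 = 0 would give mass at 0. -/
theorem exists_measure_expIntegral_eq (η : Measure ℝ≥0) [IsFiniteMeasure η]
    (hη : ∀ᵐ t ∂η, 0 < t) :
    ∃ m : Measure ℝ≥0, IsFiniteMeasure m ∧ ∀ z : ℂ, 0 ≤ z.re → z ≠ 0 →
      expIntegral m z = ∫ t : ℝ≥0, ((t : ℝ) : ℂ) * (z + ((t : ℝ) : ℂ))⁻¹ ∂η := by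
  have hfin := isFiniteMeasure_expDensity one_pos
  have hmeas : Measurable (fun p : ℝ≥0 × ℝ≥0 => p.2 / p.1) := by fun_prop
  refine ⟨(η.prod (expDensity 1)).map (fun p => p.2 / p.1), inferInstance, fun z hz hz0 => ?_⟩
  have hint := integrable_exp_neg_mul ((η.prod (expDensity 1)).map (fun p => p.2 / p.1)) hz
  have hint' := (integrable_map_measure hint.1 hmeas.aemeasurable).1 hint
  simp only [Function.comp_def] at hint'
  rw [expIntegral, integral_map hmeas.aemeasurable hint.1, integral_prod _ hint']
  refine integral_congr_ae ?_
  filter_upwards [hη] with t ht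
  have htne : ((t : ℝ) : ℂ) ≠ 0 := by exact_mod_cast ht.ne'
  have hzt : 0 ≤ (z / ((t : ℝ) : ℂ)).re := by
    rw [Complex.div_ofReal_re]
    exact div_nonneg hz t.coe_nonneg
  have h := expIntegral_expDensity one_pos hzt
  rw [expIntegral] at h
  calc ∫ u : ℝ≥0, Complex.exp (-(((u / t : ℝ≥0) : ℝ) : ℂ) * z) ∂(expDensity 1)
      = ∫ u : ℝ≥0, Complex.exp (-((u : ℝ) : ℂ) * (z / ((t : ℝ) : ℂ))) ∂(expDensity 1) := by
        refine integral_congr_ae (Eventually.of_forall fun u => ?_)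
        simp only
        congr 1
        push_cast
        ring
    _ = ((t : ℝ) : ℂ) * (z + ((t : ℝ) : ℂ))⁻¹ := by
        have hne := add_coe_ne_zero hz hz0 t
        have h1 : z / ((t : ℝ) : ℂ) + 1 = (z + ((t : ℝ) : ℂ)) / ((t : ℝ) : ℂ) := by
          field_simp
        rw [h, Complex.ofReal_one, h1, inv_div, div_eq_mul_inv]

/-! ### Stieltjes functions in the calculus. -/

section Stieltjes

variable {X : Type*} [NormedAddCommGroup X] [NormedSpace ℂ X] [CompleteSpace X]
  {T : ℝ≥0 → X →L[ℂ] X}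

omit [CompleteSpace X] in
theorem represents_const (hT : IsBoundedC0Semigroup T) (c : ℝ≥0) :
    ∃ B, Represents hT (fun _ => ((c : ℝ) : ℂ)) B := by
  refine ⟨_, represents_of_measure (c • Measure.dirac 0) fun z _ _ => ?_⟩
  rw [expIntegral, integral_smul_nnreal_measure]
  simp [NNReal.smul_def]

omit [CompleteSpace X] in
theorem represents_inv_add_one (hT : IsBoundedC0Semigroup T) [IsFiniteMeasure (expDensity 1)] :
    Represents hT (fun z => (z + 1)⁻¹) (average hT (expDensity 1)) := by
  refine represents_of_measure _ fun z hz _ => ?_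
  rw [expIntegral_expDensity one_pos hz, Complex.ofReal_one]

/-- The function `z / (1 + z)` is represented by `1 - (1 + A)⁻¹`. -/
theorem represents_div_add_one (hT : IsBoundedC0Semigroup T) [IsFiniteMeasure (expDensity 1)] :
    Represents hT (fun z => z / (z + 1)) (1 - average hT (expDensity 1)) := by
  refine (represents_one.sub (represents_inv_add_one hT)).congr fun z hz hz0 => ?_
  have : z + 1 ≠ 0 := by simpa using add_coe_ne_zero hz hz0 1
  field_simp
  ring

theorem measure_Iio_one_lt_top {μ : Measure ℝ≥0}
    (hμ : Integrable (fun t : ℝ≥0 => (1 + (t : ℝ))⁻¹) μ) : μ (Set.Iio 1) < ⊤ := by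
  refine lt_of_le_of_lt (measure_mono ?_) (hμ.measure_norm_ge_lt_top (ε := 1 / 2) (by norm_num))
  intro t ht
  have ht1 : (t : ℝ) < 1 := by exact_mod_cast ht
  have ht0 := t.coe_nonneg
  rw [Set.mem_ofPred_eq, norm_inv, Real.norm_of_nonneg (by positivity), one_div]
  exact inv_anti₀ (by positivity) (by linarith)

omit [CompleteSpace X] in
-- The factor z removes the singularity at 0: z/(z + t) = 1 - t/(z + t), and μ is finite on [0, 1).
theorem exists_represents_mul_integral_Iio (hT : IsBoundedC0Semigroup T) {μ : Measure ℝ≥0}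
    (hμ : Integrable (fun t : ℝ≥0 => (1 + (t : ℝ))⁻¹) μ) :
    ∃ B, Represents hT (fun z => z * ∫ t in Set.Iio (1 : ℝ≥0), (z + ((t : ℝ) : ℂ))⁻¹ ∂μ) B := by
  have hfin := measure_Iio_one_lt_top hμ
  have : IsFiniteMeasure (μ.restrict (Set.Iio 1)) := ⟨by simpa using hfin⟩
  have : IsFiniteMeasure (μ.restrict (Set.Ioo 0 1)) :=
    ⟨by simpa using (measure_mono Set.Ioo_subset_Iio_self).trans_lt hfin⟩
  obtain ⟨m, hm, hmz⟩ := exists_measure_expIntegral_eq (μ.restrict (Set.Ioo 0 1))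
    ((ae_restrict_mem measurableSet_Ioo).mono fun t ht => ht.1)
  obtain ⟨C, hC⟩ := represents_const hT (μ (Set.Iio 1)).toNNReal
  refine ⟨_, (hC.sub (represents_of_measure m fun z _ _ => rfl)).congr fun z hz hz0 => ?_⟩
  have hint : IntegrableOn (fun t : ℝ≥0 => (z + ((t : ℝ) : ℂ))⁻¹) (Set.Iio 1) μ :=
    (integrable_inv_add_coe hμ hz hz0).integrableOn
  have hpt : ∀ t : ℝ≥0, ((t : ℝ) : ℂ) * (z + ((t : ℝ) : ℂ))⁻¹ =
      1 - z * (z + ((t : ℝ) : ℂ))⁻¹ := by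
    intro t
    have := add_coe_ne_zero hz hz0 t
    field_simp
    ring
  have hsub : ∫ t in Set.Ioo (0 : ℝ≥0) 1, ((t : ℝ) : ℂ) * (z + ((t : ℝ) : ℂ))⁻¹ ∂μ =
      ∫ t in Set.Iio (1 : ℝ≥0), ((t : ℝ) : ℂ) * (z + ((t : ℝ) : ℂ))⁻¹ ∂μ := by
    refine (setIntegral_eq_of_subset_of_forall_sdiff_eq_zero measurableSet_Iio
      Set.Ioo_subset_Iio_self fun t ht => ?_).symm
    have : t = 0 := by
      by_contra h
      exact ht.2 ⟨pos_iff_ne_zero.2 h, ht.1⟩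
    simp [this]
  have hval : ∫ t in Set.Iio (1 : ℝ≥0), ((t : ℝ) : ℂ) * (z + ((t : ℝ) : ℂ))⁻¹ ∂μ =
      (((μ (Set.Iio 1)).toNNReal : ℝ) : ℂ) -
        z * ∫ t in Set.Iio (1 : ℝ≥0), (z + ((t : ℝ) : ℂ))⁻¹ ∂μ := by
    simp_rw [hpt]
    rw [integral_sub (integrable_const _) (hint.const_mul z), integral_const_mul]
    congr 1
    simp [measureReal_def, ENNReal.toReal]
  simp only [hmz z hz hz0, hsub, hval]
  ring

omit [CompleteSpace X] in
-- Here 1/(z + t) = t⁻¹ · t/(z + t), and t⁻¹ μ(dt) is finite on [1, ∞).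
theorem exists_represents_integral_Ici (hT : IsBoundedC0Semigroup T) {μ : Measure ℝ≥0}
    (hμ : Integrable (fun t : ℝ≥0 => (1 + (t : ℝ))⁻¹) μ) :
    ∃ B, Represents hT (fun z => ∫ t in Set.Ici (1 : ℝ≥0), (z + ((t : ℝ) : ℂ))⁻¹ ∂μ) B := by
  have hint : IntegrableOn (fun t : ℝ≥0 => (t : ℝ)⁻¹) (Set.Ici 1) μ := by
    refine ((hμ.const_mul 2).integrableOn (s := Set.Ici 1)).mono' (by fun_prop) ?_
    refine (ae_restrict_mem measurableSet_Ici).mono fun t ht => ?_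
    have ht1 : (1 : ℝ) ≤ t := by exact_mod_cast ht
    rw [Real.norm_of_nonneg (by positivity), ← div_eq_mul_inv, inv_eq_one_div,
      div_le_div_iff₀ (by positivity) (by positivity)]
    linarith
  set η := (μ.restrict (Set.Ici 1)).withDensity
    (fun t : ℝ≥0 => ENNReal.ofReal ((t : ℝ)⁻¹)) with hη
  have : IsFiniteMeasure η := isFiniteMeasure_withDensity_ofReal hint.2
  have hpos : ∀ᵐ t ∂(μ.restrict (Set.Ici (1 : ℝ≥0))), 0 < t :=
    (ae_restrict_mem measurableSet_Ici).mono fun t ht => lt_of_lt_of_le one_pos ht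
  obtain ⟨m, hm, hmz⟩ := exists_measure_expIntegral_eq η
    ((withDensity_absolutelyContinuous _ _).ae_le hpos)
  refine ⟨_, represents_of_measure m fun z hz hz0 => ?_⟩
  rw [hmz z hz hz0, hη, integral_withDensity_eq_integral_toReal_smul (by fun_prop) (by simp)]
  refine integral_congr_ae (hpos.mono fun t ht => ?_)
  have htne : ((t : ℝ) : ℂ) ≠ 0 := by exact_mod_cast ht.ne'
  simp only
  rw [ENNReal.toReal_ofReal (by positivity), Complex.real_smul, Complex.ofReal_inv, ← mul_assoc,
    inv_mul_cancel₀ htne, one_mul]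

theorem IsStieltjes.exists_represents {f : ℂ → ℂ} (hf : IsStieltjes f)
    (hT : IsBoundedC0Semigroup T) : ∃ B, Represents hT (fun z => z / (z + 1) * f z) B := by
  obtain ⟨a, μ, ha, hμ, hfz⟩ := hf
  have := isFiniteMeasure_expDensity one_pos
  lift a to ℝ≥0 using ha
  obtain ⟨B₀, hB₀⟩ := represents_const hT a
  obtain ⟨B₁, hB₁⟩ := exists_represents_mul_integral_Iio hT hμ
  obtain ⟨B₂, hB₂⟩ := exists_represents_integral_Ici hT hμ
  have he := represents_div_add_one hT
  refine ⟨_, (((represents_inv_add_one hT).mul hB₁).add (he.mul (hB₀.add hB₂))).congr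
    fun z hz hz0 => ?_⟩
  have hint := integrable_inv_add_coe hμ hz hz0
  have hsplit := integral_add_compl (measurableSet_Iio (a := (1 : ℝ≥0))) hint
  rw [Set.compl_Iio] at hsplit
  simp only [hfz z (mem_slitPlane_of_re_nonneg hz hz0), ← hsplit]
  ring

end Stieltjes

/-! ### Comparison of values on the positive and imaginary axes. -/

theorem IsStieltjes.exists_real_value {f : ℂ → ℂ} (hf : IsStieltjes f) {r : ℝ} (hr : 0 < r) :
    ∃ c : ℝ, 0 ≤ c ∧ f (r : ℂ) = c ∧
      ∀ w : ℝ, |w| = r → c ≤ Real.sqrt 2 * ‖f (w * Complex.I)‖ := by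
  obtain ⟨a, μ, ha, hμ, hfz⟩ := hf
  have hrne : (r : ℂ) ≠ 0 := by exact_mod_cast hr.ne'
  have hrre : 0 ≤ (r : ℂ).re := by simpa using hr.le
  have hreal : ∀ t : ℝ≥0, ((r : ℂ) + ((t : ℝ) : ℂ))⁻¹ = (((r + t)⁻¹ : ℝ) : ℂ) := by
    intro t; push_cast; rfl
  have hint := integrable_inv_add_coe hμ hrre hrne
  have hint' : Integrable (fun t : ℝ≥0 => (r + (t : ℝ))⁻¹) μ := by
    have := hint.re
    simp_rw [hreal] at this
    exact this
  refine ⟨a + ∫ t : ℝ≥0, (r + (t : ℝ))⁻¹ ∂μ, ?_, ?_, fun w hw => ?_⟩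
  · refine add_nonneg ha (integral_nonneg fun t => ?_)
    have := t.coe_nonneg
    positivity
  · rw [hfz _ (mem_slitPlane_of_re_nonneg hrre hrne)]
    simp_rw [hreal]
    rw [Complex.ofReal_add, ← integral_complex_ofReal]
  obtain ⟨σ, hσ, hσw⟩ : ∃ σ : ℝ, σ ^ 2 = 1 ∧ σ * w = r := by
    rcases abs_choice w with h | h
    · exact ⟨1, by norm_num, by rw [one_mul, ← h, hw]⟩
    · exact ⟨-1, by norm_num, by rw [neg_one_mul, ← h, hw]⟩
  have hw2 : w ^ 2 = r ^ 2 := by rw [← hw, sq_abs]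
  have hwre : 0 ≤ ((w : ℂ) * Complex.I).re := by simp
  have hwne : (w : ℂ) * Complex.I ≠ 0 := by
    have : w ≠ 0 := by
      rintro rfl
      simp at hw
      exact hr.ne hw
    simpa using this
  have hintw := integrable_inv_add_coe hμ hwre hwne
  -- The rotation by ±45°, scaled by √2, makes every kernel 1/(iw + t) have real part (t + r)/(t² +
  -- r²) ≥ 1/(t + r). Hence no cancellation occurs in the integral.
  set u : ℂ := 1 + σ * Complex.I with hu
  have hnorm : ‖u‖ = Real.sqrt 2 := by
    rw [Complex.norm_def, Complex.normSq_apply]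
    congr 1
    simp [hu]
    nlinarith
  have hpt : ∀ t : ℝ≥0, (r + (t : ℝ))⁻¹ ≤
      (u * ((w : ℂ) * Complex.I + ((t : ℝ) : ℂ))⁻¹).re := by
    intro t
    have ht := t.coe_nonneg
    have h1 : (u * ((w : ℂ) * Complex.I + ((t : ℝ) : ℂ))⁻¹).re =
        ((t : ℝ) + r) / ((t : ℝ) ^ 2 + r ^ 2) := by
      rw [Complex.mul_re, Complex.inv_re, Complex.inv_im, Complex.normSq_apply, ← hσw]
      have hsq : (σ * w) ^ 2 = w ^ 2 := by rw [mul_pow, hσ, one_mul]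
      rw [hsq]
      simp [hu]
      ring
    rw [h1, inv_eq_one_div, div_le_div_iff₀ (by positivity) (by positivity)]
    nlinarith [mul_nonneg ht hr.le]
  have hre : a + ∫ t : ℝ≥0, (r + (t : ℝ))⁻¹ ∂μ ≤ (u * f (w * Complex.I)).re := by
    rw [hfz _ (mem_slitPlane_of_re_nonneg hwre hwne), mul_add, Complex.add_re,
      ← integral_const_mul]
    refine add_le_add (le_of_eq (by simp [hu])) ?_
    have h2 := integral_re (hintw.const_mul u)
    simp only [RCLike.re_to_complex] at h2
    rw [← h2]
    exact integral_mono hint' (by simpa using (hintw.const_mul u).re) hpt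
  refine hre.trans ((Complex.re_le_norm _).trans ?_)
  rw [norm_mul, hnorm]

theorem IsStieltjesProduct.re_le_norm {f : ℂ → ℂ} (hf : IsStieltjesProduct f) {w : ℝ}
    (hw : w ≠ 0) : (f ((|w| : ℝ) : ℂ)).re ≤ 2 * ‖f (w * Complex.I)‖ := by
  obtain ⟨f₁, f₂, h₁, h₂, hf⟩ := hf
  have hpos := abs_pos.2 hw
  obtain ⟨c₁, hc₁, he₁, hl₁⟩ := h₁.exists_real_value hpos
  obtain ⟨c₂, hc₂, he₂, hl₂⟩ := h₂.exists_real_value hpos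
  have hm1 : ((|w| : ℝ) : ℂ) ∈ Complex.slitPlane := by simpa using hw
  have hm2 : (w : ℂ) * Complex.I ∈ Complex.slitPlane :=
    mem_slitPlane_of_re_nonneg (by simp) (by simpa using hw)
  rw [hf _ hm1, hf _ hm2, he₁, he₂, ← Complex.ofReal_mul, Complex.ofReal_re, norm_mul]
  calc c₁ * c₂ ≤ (Real.sqrt 2 * ‖f₁ (w * Complex.I)‖) * (Real.sqrt 2 * ‖f₂ (w * Complex.I)‖) :=
        mul_le_mul (hl₁ w rfl) (hl₂ w rfl) hc₂ (by positivity)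
    _ = (Real.sqrt 2 * Real.sqrt 2) * (‖f₁ (w * Complex.I)‖ * ‖f₂ (w * Complex.I)‖) := by ring
    _ = 2 * (‖f₁ (w * Complex.I)‖ * ‖f₂ (w * Complex.I)‖) := by
        rw [Real.mul_self_sqrt (by norm_num)]

/-! ### Dense range implies injectivity. -/

section Injectivity

variable {X : Type*} [NormedAddCommGroup X] [NormedSpace ℂ X] [CompleteSpace X]
  {T : ℝ≥0 → X →L[ℂ] X} {A : X →ₗ.[ℂ] X}

/-- If the range of `A` is dense, then `A` is injective. -/
theorem eq_zero_of_map_eq_zero (hT : IsBoundedC0Semigroup T) (hA : IsNegGenerator T A)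
    (hran : Dense (Set.range (fun x : A.domain => A x))) (x : A.domain) (hx : A x = 0) :
    (x : X) = 0 := by
  obtain ⟨M, hM0, hM⟩ := hT.exists_bound
  -- Mean ergodic argument: r(r + A)⁻¹ fixes the kernel, is bounded by M, and sends Aw to r(w - r(r
  -- + A)⁻¹w), which vanishes as r → 0.
  have key : ∀ (r : ℝ), 0 < r → ∀ w : A.domain,
      ‖(x : X)‖ ≤ M * ‖(x : X) - A w‖ + r * ((1 + M) * ‖(w : X)‖) := by
    intro r hr w
    have hl : 0 < (r : ℂ).re := by simpa using hr
    obtain ⟨-, h2⟩ := isBoundedInverse_resolventOf hT hA hl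
    set R := resolventOf hT hl with hR
    have hRM : ∀ y, ‖(r : ℂ) • R y‖ ≤ M * ‖y‖ := by
      intro y
      rw [norm_smul, Complex.norm_real, Real.norm_of_nonneg hr.le]
      have := norm_integral_exp_smul_le hM hl y
      rw [← resolventOf_apply hT hl, ← hR, Complex.ofReal_re] at this
      calc r * ‖R y‖ ≤ r * (M / r * ‖y‖) := by gcongr
        _ = M * ‖y‖ := by field_simp
    have h3 := h2 x
    rw [hx, smul_zero, add_zero, map_smul] at h3
    have h4 := h2 w
    rw [one_smul, map_add, map_smul] at h4
    have h5 : (x : X) = (r : ℂ) • R (x - A w) + (r : ℂ) • ((w : X) - (r : ℂ) • R w) := by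
      have h6 : R (A w) = (w : X) - (r : ℂ) • R w := by
        rw [eq_sub_iff_add_eq', h4]
      rw [map_sub, smul_sub, h3, h6]
      abel
    calc ‖(x : X)‖ = ‖(r : ℂ) • R (x - A w) + (r : ℂ) • ((w : X) - (r : ℂ) • R w)‖ := by
          rw [← h5]
      _ ≤ ‖(r : ℂ) • R (x - A w)‖ + ‖(r : ℂ) • ((w : X) - (r : ℂ) • R w)‖ := norm_add_le _ _
      _ ≤ M * ‖(x : X) - A w‖ + r * ((1 + M) * ‖(w : X)‖) := by
          refine add_le_add (hRM _) ?_
          rw [norm_smul, Complex.norm_real, Real.norm_of_nonneg hr.le]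
          refine mul_le_mul_of_nonneg_left ((norm_sub_le _ _).trans ?_) hr.le
          rw [add_mul, one_mul]
          exact add_le_add le_rfl (hRM _)
  have h0 : ‖(x : X)‖ ≤ 0 := by
    refine le_of_forall_pos_le_add fun δ hδ => ?_
    -- The radius here and the later choice r = δ/(2(q + 1)) contribute δ/2 each; the added ones
    -- keep the denominators positive.
    obtain ⟨-, ⟨w, rfl⟩, hball⟩ := hran.exists_dist_lt (x : X)
      (show 0 < δ / (2 * (M + 1)) by positivity)
    have hw : M * ‖(x : X) - A w‖ ≤ δ / 2 := by
      rw [dist_eq_norm] at hball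
      calc M * ‖(x : X) - A w‖ ≤ (M + 1) * (δ / (2 * (M + 1))) := by
            gcongr
            linarith
        _ = δ / 2 := by field_simp
    set q := (1 + M) * ‖(w : X)‖ with hq
    have hq0 : 0 ≤ q := by positivity
    have hr : δ / (2 * (q + 1)) * q ≤ δ / 2 := by
      rw [div_mul_eq_mul_div, div_le_div_iff₀ (by positivity) (by positivity)]
      nlinarith
    have := key (δ / (2 * (q + 1))) (by positivity) w
    linarith
  exact norm_le_zero_iff.1 h0

theorem injective_one_sub_average (hT : IsBoundedC0Semigroup T) (hA : IsNegGenerator T A)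
    (hran : Dense (Set.range (fun x : A.domain => A x))) [IsFiniteMeasure (expDensity 1)] :
    Function.Injective ⇑(1 - average hT (expDensity 1) : X →L[ℂ] X) := by
  rw [injective_iff_map_eq_zero]
  intro x hx
  rw [sub_apply, one_apply_eq_self, sub_eq_zero, ← resolventOf_real hT one_pos] at hx
  obtain ⟨h1, -⟩ := isBoundedInverse_resolventOf hT hA (l := ((1 : ℝ) : ℂ)) (by simp)
  obtain ⟨hm, hy⟩ := h1 x
  have hAx : A ⟨_, hm⟩ = 0 := by
    rw [one_smul, Complex.coe_smul, one_smul] at hy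
    exact add_eq_left.1 (hy.trans hx)
  exact hx.trans (eq_zero_of_map_eq_zero hT hA hran _ hAx)

end Injectivity

/-! ### The regularizer (z/(1+z))². -/

section Regularizer

variable {X : Type*} [NormedAddCommGroup X] [NormedSpace ℂ X] [CompleteSpace X]
  {T : ℝ≥0 → X →L[ℂ] X} {A : X →ₗ.[ℂ] X}

/-- A product of Stieltjes functions is regularized by `(z / (1 + z)) ^ 2`. -/
theorem IsStieltjesProduct.exists_operator {f : ℂ → ℂ} (hf : IsStieltjesProduct f)
    (hT : IsBoundedC0Semigroup T) (hA : IsNegGenerator T A)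
    (hran : Dense (Set.range (fun x : A.domain => A x))) :
    ∃ B : X →L[ℂ] X, Represents hT (fun z => (z / (z + 1)) ^ 2 * f z) B ∧
      ∀ w, B w ∈ extendedCalculusRange T f := by
  have := isFiniteMeasure_expDensity one_pos
  obtain ⟨f₁, f₂, h₁, h₂, hprod⟩ := hf
  obtain ⟨B₁, hB₁⟩ := h₁.exists_represents hT
  obtain ⟨B₂, hB₂⟩ := h₂.exists_represents hT
  set E : X →L[ℂ] X := 1 - average hT (expDensity 1) with hE
  have he : Represents hT (fun z => (z / (z + 1)) ^ 2) (E * E) :=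
    ((represents_div_add_one hT).mul (represents_div_add_one hT)).congr fun z _ _ => sq _
  have hef : Represents hT (fun z => (z / (z + 1)) ^ 2 * f z) (B₁ * B₂) := by
    refine (hB₁.mul hB₂).congr fun z hz hz0 => ?_
    simp only [hprod z (mem_slitPlane_of_re_nonneg hz hz0)]
    ring
  -- The preimage of (ef)(A)w under f(A) is e(A)w, as the operators of the calculus commute.
  -- Holomorphy of f comes from the quotient (ef)/e.
  refine ⟨_, hef, fun w => ⟨(E * E) w, ?_, ?_⟩⟩
  · refine (hef.differentiableOn.div he.differentiableOn fun z hz => ?_).congr fun z hz => ?_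
    all_goals
      have hz0 : z ≠ 0 := by
        rintro rfl
        simp at hz
      have hz1 : z + 1 ≠ 0 := by simpa using add_coe_ne_zero (le_of_lt hz) hz0 1
    · exact pow_ne_zero _ (div_ne_zero hz0 hz1)
    · simp only [Pi.div_apply]
      rw [mul_div_cancel_left₀]
      exact pow_ne_zero _ (div_ne_zero hz0 hz1)
  · obtain ⟨μ, hμ, hμT⟩ := he.exists_complexMeasure
    obtain ⟨ν, hν, hνT⟩ := hef.exists_complexMeasure
    refine ⟨μ, ν, ⟨fun z hz => ?_, ?_⟩, ?_⟩
    · rw [hμ z hz, hν z hz]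
    · rw [hμT]
      have hinj := injective_one_sub_average hT hA hran
      exact hinj.comp hinj
    · rw [hμT, hνT]
      exact he.commute hef w

end Regularizer

/-! ### Asymptotic eigenvalues. -/

section Multiplier

variable {X : Type*} [NormedAddCommGroup X] [NormedSpace ℂ X] {v : ℕ → X} {S S' : X →L[ℂ] X}
  {c c' : ℂ}

/-- The vectors `v k` are asymptotically eigenvectors of `S` for the eigenvalue `c`. -/
def IsAsymptoticEigenvalue (v : ℕ → X) (S : X →L[ℂ] X) (c : ℂ) : Prop :=
  Tendsto (fun k => S (v k) - c • v k) atTop (𝓝 0)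

theorem IsAsymptoticEigenvalue.sub (h : IsAsymptoticEigenvalue v S c)
    (h' : IsAsymptoticEigenvalue v S' c') : IsAsymptoticEigenvalue v (S - S') (c - c') := by
  have := Tendsto.sub h h'
  rw [sub_zero] at this
  refine this.congr fun k => ?_
  rw [sub_apply, sub_smul]
  abel

theorem IsAsymptoticEigenvalue.smul (h : IsAsymptoticEigenvalue v S c) (a : ℂ) :
    IsAsymptoticEigenvalue v (a • S) (a * c) := by
  have := Tendsto.const_smul h a
  rw [smul_zero] at this
  refine this.congr fun k => ?_
  rw [smul_apply, smul_sub, mul_smul]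

theorem IsAsymptoticEigenvalue.mul (h : IsAsymptoticEigenvalue v S c)
    (h' : IsAsymptoticEigenvalue v S' c') : IsAsymptoticEigenvalue v (S * S') (c * c') := by
  have h1 := (S.continuous.tendsto 0).comp h'
  have := h1.add (Tendsto.const_smul h c')
  rw [map_zero, smul_zero, add_zero] at this
  refine this.congr fun k => ?_
  simp only [Function.comp_apply, map_sub, map_smul, mul_apply_eq_comp]
  module

theorem IsAsymptoticEigenvalue.norm_le (h : IsAsymptoticEigenvalue v S c)
    (hv : ∀ k, ‖v k‖ = 1) : ‖c‖ ≤ ‖S‖ := by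
  have h1 : Tendsto (fun k => ‖S‖ + ‖S (v k) - c • v k‖) atTop (𝓝 (‖S‖ + 0)) :=
    tendsto_const_nhds.add (by simpa using h.norm)
  rw [add_zero] at h1
  refine ge_of_tendsto' h1 fun k => ?_
  have h2 : ‖c • v k‖ = ‖c‖ := by rw [norm_smul, hv, mul_one]
  have h3 : ‖S (v k)‖ ≤ ‖S‖ := by simpa [hv k] using S.le_opNorm (v k)
  have h4 := norm_sub_norm_le (c • v k) (S (v k))
  rw [norm_sub_rev] at h4
  linarith

end Multiplier

/-! ### The lower bound at a spectral point. -/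

section LowerBound

variable {X : Type*} [NormedAddCommGroup X] [NormedSpace ℂ X] [CompleteSpace X]
  {T : ℝ≥0 → X →L[ℂ] X} {A : X →ₗ.[ℂ] X}

theorem Represents.isAsymptoticEigenvalue {hT : IsBoundedC0Semigroup T} {g : ℂ → ℂ}
    {B : X →L[ℂ] X} (hg : Represents hT g B) {w : ℝ} (hw : w ≠ 0) {v : ℕ → X}
    (hv : ∀ k, ‖v k‖ = 1)
    (hvT : ∀ t : ℝ≥0, IsAsymptoticEigenvalue v (T t)
      (Complex.exp (-((t : ℝ) : ℂ) * (w * Complex.I)))) :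
    IsAsymptoticEigenvalue v B (g (w * Complex.I)) := by
  obtain ⟨m, n, hm, hn, h1, rfl⟩ := hg
  rw [h1 _ (by simp) (by simpa using hw)]
  exact IsAsymptoticEigenvalue.sub (tendsto_average_approximate_eigenvectors hT hv hvT m)
    (tendsto_average_approximate_eigenvectors hT hv hvT n)

/-- For w ≠ 0 the value is 1/√2; the rational bound 3/4 leaves the gap 1/4 to |e^{-itw}| = 1. -/
theorem abs_mul_norm_inv_le (w : ℝ) :
    ‖((|w| : ℝ) : ℂ) * ((w : ℂ) * Complex.I + ((|w| : ℝ) : ℂ))⁻¹‖ ≤ 3 / 4 := by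
  rcases eq_or_ne w 0 with rfl | hw
  · norm_num
  have hpos := abs_pos.2 hw
  have hsq : ‖(w : ℂ) * Complex.I + ((|w| : ℝ) : ℂ)‖ ^ 2 = 2 * w ^ 2 := by
    rw [Complex.sq_norm, Complex.normSq_apply]
    simp
    ring
  have hn : 0 < ‖(w : ℂ) * Complex.I + ((|w| : ℝ) : ℂ)‖ := by
    refine norm_pos_iff.2 fun h => hw ?_
    rw [h] at hsq
    simpa using hsq.symm
  rw [norm_mul, norm_inv, Complex.norm_real, norm_abs_eq_norm, Real.norm_eq_abs,
    ← div_eq_mul_inv, div_le_iff₀ hn]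
  refine le_of_sq_le_sq ?_ (by positivity)
  rw [mul_pow, hsq, sq_abs]
  nlinarith [sq_nonneg w]

theorem half_le_norm_sq_div {w : ℝ} (hw : 1 ≤ |w|) :
    1 / 2 ≤ ‖((w : ℂ) * Complex.I / ((w : ℂ) * Complex.I + 1)) ^ 2‖ := by
  have hw2 : 1 ≤ w ^ 2 := by
    rw [← sq_abs]
    nlinarith
  have hsq : ‖(w : ℂ) * Complex.I + 1‖ ^ 2 = w ^ 2 + 1 := by
    rw [Complex.sq_norm, Complex.normSq_apply]
    simp
    ring
  rw [norm_pow, norm_div, div_pow, hsq, norm_mul, Complex.norm_I, mul_one, Complex.norm_real,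
    Real.norm_eq_abs, sq_abs, div_le_div_iff₀ (by norm_num) (by positivity)]
  linarith

theorem re_le_norm_eulerError_mul {f : ℂ → ℂ} (hf : IsStieltjesProduct f)
    (hT : IsBoundedC0Semigroup T) (hA : IsNegGenerator T A) {B : X →L[ℂ] X}
    (hB : Represents hT (fun z => (z / (z + 1)) ^ 2 * f z) B) {w : ℝ} (hw : 1 ≤ |w|)
    (hspec : (w : ℂ) * Complex.I ∈ opSpectrum A) {t : ℝ≥0} (ht : (t : ℝ) = |w|⁻¹) :
    (f ((|w| : ℝ) : ℂ)).re / 16 ≤ ‖eulerError T A 1 t * B‖ := by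
  have hpos : 0 < |w| := by linarith
  have hw0 : w ≠ 0 := abs_pos.1 hpos
  obtain ⟨v, hv, hvT⟩ := exists_approximate_eigenvectors hT hA hspec
  have hBv := hB.isAsymptoticEigenvalue hw0 hv hvT
  have htpos : 0 < (t : ℝ) := ht ▸ inv_pos.2 hpos
  have := isFiniteMeasure_expDensity (inv_pos.2 htpos)
  have hstep : IsAsymptoticEigenvalue v (backwardStep A ((t : ℝ) / (1 : ℕ)) ^ 1)
      (((|w| : ℝ) : ℂ) * ((w : ℂ) * Complex.I + ((|w| : ℝ) : ℂ))⁻¹) := by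
    rw [pow_one, Nat.cast_one, div_one, backwardStep_eq hT hA htpos]
    have h := tendsto_average_approximate_eigenvectors hT hv hvT (expDensity ((t : ℝ)⁻¹))
    rw [expIntegral_expDensity (inv_pos.2 htpos) (by simp)] at h
    have h2 := IsAsymptoticEigenvalue.smul h (((t : ℝ) : ℂ)⁻¹)
    convert h2 using 2
    · rw [ht, Complex.ofReal_inv, inv_inv]
    · rw [ht, inv_inv]
  have hall := ((hstep.sub (hvT t)).mul hBv).norm_le hv
  refine le_trans ?_ hall
  have hexp : ‖Complex.exp (-((t : ℝ) : ℂ) * (w * Complex.I))‖ = 1 := by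
    rw [Complex.norm_exp]
    simp
  have h1 := norm_sub_norm_le (Complex.exp (-((t : ℝ) : ℂ) * (w * Complex.I)))
    (((|w| : ℝ) : ℂ) * ((w : ℂ) * Complex.I + ((|w| : ℝ) : ℂ))⁻¹)
  rw [norm_sub_rev, hexp] at h1
  have h2 := abs_mul_norm_inv_le w
  have h3 := half_le_norm_sq_div hw
  have h4 := hf.re_le_norm hw0
  rw [norm_mul, norm_mul]
  -- The constant is 16 = 4 · 2 · 2, from the Euler error, the regularizer and the passage from |w|
  -- to iw.
  calc (f ((|w| : ℝ) : ℂ)).re / 16 ≤ 1 / 4 * (1 / 2 * ‖f (w * Complex.I)‖) := by linarith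
    _ ≤ _ := by
        gcongr
        linarith

end LowerBound

theorem tendsto_sqrtRatioFilter {w : ℕ → ℝ} (hw : Tendsto w atTop atTop) (hpos : ∀ k, 0 < w k) :
    Tendsto (fun k => ((1 : ℕ), (w k).toNNReal⁻¹)) atTop sqrtRatioFilter := by
  refine tendsto_inf.2 ⟨tendsto_comap_iff.2 (hw.congr fun k => ?_),
    tendsto_principal.2 (Eventually.of_forall fun k => ⟨le_rfl, ?_⟩)⟩
  · simp [(hpos k).le]
  · simpa using hpos k

end EulerRate

/-! ### The resonance argument. -/

theorem corollary6p6 {X : Type*} [NormedAddCommGroup X] [NormedSpace ℂ X] [CompleteSpace X]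
    (T : ℝ≥0 → X →L[ℂ] X) (hT : IsBoundedC0Semigroup T)
    (A : X →ₗ.[ℂ] X) (hA : IsNegGenerator T A)
    (hran : Dense (Set.range (fun x : A.domain => A x)))
    (hspec : ∀ r : ℝ, ∃ s : ℝ, r < |s| ∧ (s : ℂ) * Complex.I ∈ opSpectrum A)
    (f : ℂ → ℂ) (hf : IsStieltjesProduct f)
    (hlim : Tendsto (fun τ : ℝ => τ ^ 2 * (f (τ : ℂ)).re) atTop atTop)
    (ε : ℝ → ℝ) (hεpos : ∀ τ, 0 < τ → 0 < ε τ) (hεanti : AntitoneOn ε (Set.Ioi 0))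
    (hεlim : Tendsto ε atTop (𝓝 0)) :
    ∃ y ∈ extendedCalculusRange T f,
      limsup (fun p : ℕ × ℝ≥0 =>
        ((‖eulerError T A p.1 p.2 y‖ /
          (ε (Real.sqrt p.1 / (p.2 : ℝ)) *
            (f ((Real.sqrt p.1 / (p.2 : ℝ) : ℝ) : ℂ)).re) : ℝ) : EReal))
        sqrtRatioFilter = ⊤ := by
  obtain ⟨B, hB, hBran⟩ := hf.exists_operator hT hA hran
  obtain ⟨r₀, hr₀⟩ := eventually_atTop.1 (hlim.eventually_gt_atTop 0)
  -- Beyond r₀ the growth hypothesis makes f positive; k + 1 forces |s k| → ∞ and |s k| ≥ 1.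
  choose s hs hsσ using fun k : ℕ => hspec (max r₀ (k + 1))
  have hs1 : ∀ k : ℕ, (k : ℝ) + 1 < |s k| := fun k => (le_max_right _ _).trans_lt (hs k)
  have hspos : ∀ k, 0 < |s k| := fun k => by
    exact lt_trans (by positivity) (hs1 k)
  have hs_atTop : Tendsto (fun k => |s k|) atTop atTop :=
    tendsto_atTop_mono (fun k => by linarith [hs1 k]) (tendsto_natCast_atTop_atTop (R := ℝ))
  have hfpos : ∀ k, 0 < (f ((|s k| : ℝ) : ℂ)).re := fun k =>
    pos_of_mul_pos_right (hr₀ _ ((le_max_left _ _).trans (hs k).le)) (by positivity)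
  set q : ℕ → ℝ := fun k => ε |s k| * (f ((|s k| : ℝ) : ℂ)).re with hq
  have hqpos : ∀ k, 0 < q k := fun k => mul_pos (hεpos _ (hspos k)) (hfpos k)
  set D : ℕ → X →L[ℂ] X := fun k =>
    ((q k : ℂ)⁻¹) • (eulerError T A 1 (|s k|.toNNReal)⁻¹ * B) with hD
  have hDnorm : ∀ k w, ‖D k w‖ = ‖eulerError T A 1 (|s k|.toNNReal)⁻¹ (B w)‖ / q k := by
    intro k w
    rw [hD]
    simp only [smul_apply, mul_apply_eq_comp]
    rw [norm_smul, norm_inv, Complex.norm_real, Real.norm_of_nonneg (hqpos k).le, inv_mul_eq_div]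
  have hDlower : ∀ k, (16 * ε |s k|)⁻¹ ≤ ‖D k‖ := by
    intro k
    have h := re_le_norm_eulerError_mul hf hT hA hB (by have := hs1 k; linarith) (hsσ k)
      (t := (|s k|.toNNReal)⁻¹) (by simp)
    have hε := hεpos _ (hspos k)
    rw [hD]
    simp only
    rw [norm_smul, norm_inv, Complex.norm_real, Real.norm_of_nonneg (hqpos k).le, inv_mul_eq_div,
      le_div_iff₀ (hqpos k)]
    refine le_trans (le_of_eq ?_) h
    simp only [hq]
    field_simp
  obtain ⟨w, hw⟩ : ∃ w, ∀ C, ∃ k, C < ‖D k w‖ := by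
    by_contra! hcon
    obtain ⟨C, hC⟩ := banach_steinhaus hcon
    have h1 : Tendsto (fun k => 16 * ε |s k|) atTop (𝓝[>] 0) := by
      refine tendsto_nhdsWithin_iff.2 ⟨?_, Eventually.of_forall fun k => ?_⟩
      · simpa using (hεlim.comp hs_atTop).const_mul 16
      · have := hεpos _ (hspos k)
        simpa using this
    obtain ⟨k, hk⟩ := ((h1.inv_tendsto_nhdsGT_zero).eventually_gt_atTop C).exists
    exact absurd (hDlower k) (not_le.2 ((hC k).trans_lt hk))
  -- A real sequence that is eventually bounded above is bounded above, so unboundedness recurs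
  -- arbitrarily far out.
  have hfreq : ∀ C, ∃ᶠ k in atTop, C ≤ ‖D k w‖ := by
    intro C hC
    have hbdd : IsBoundedUnder (· ≤ ·) atTop fun k => ‖D k w‖ :=
      ⟨C, eventually_map.2 (hC.mono fun k hk => (not_le.1 hk).le)⟩
    obtain ⟨C', hC'⟩ := hbdd.bddAbove_range
    obtain ⟨k, hk⟩ := hw C'
    exact absurd (hC' ⟨k, rfl⟩) (not_le.2 hk)
  refine ⟨B w, hBran w, ?_⟩
  rw [EReal.eq_top_iff_forall_lt]
  intro C
  -- Frequent lower bounds give only a weak inequality for the limsup; passing to C + 1 makes it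
  -- strict.
  refine lt_of_lt_of_le (EReal.coe_lt_coe_iff.2 (lt_add_one C)) ?_
  refine le_limsup_of_frequently_le ((tendsto_sqrtRatioFilter hs_atTop hspos).frequently ?_)
  refine (hfreq (C + 1)).mono fun k hk => EReal.coe_le_coe_iff.2 ?_
  rw [hDnorm] at hk
  simpa [hq] using hk
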